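/- Let $F$ and $G$ be probability distributions on $(0,\infty)$ (their distribution functions are denoted by the same letters), with no further restriction; in particular both may have atoms, also common ones. Let $T_1,T_2,\dots$ be i.i.d. with law $F$ and $C_1,C_2,\dots$ i.i.d. with law $G$, the sequence $(T_i)$ being independent of the sequence $(C_i)$. Put $X_i=\min(T_i,C_i)$, $\Delta_i=\mathbf 1_{\{T_i\le C_i\}}$, $S=1-F$, and let $H$ be the distribution function of $X_1$. Write $f(x-)$ for the left limit of $f$ at $x$, let $I_H=\{t>0: H(t-)<1\}$, and let $\int_0^\tau$ denote integration over $I_H$. For each $n$, order the sample $(X_1,\Delta_1),\dots,(X_n,\Delta_n)$ increasingly in the times as $(X_{[1:n]},\Delta_{[1:n]}),\dots,(X_{[n:n]},\Delta_{[n:n]})$, where at tied times the uncensored observations ($\Delta=1$) precede the censored ones and all other ties are ordered arbitrarily, and let $$W_i=\frac{\Delta_{[i:n]}}{n}\prod_{j=1}^{i-1}\left(1+\frac{1-\Delta_{[j:n]}}{n-j}\right),\qquad i=1,\dots,n,$$ be the Kaplan--Meier weights. Let $K:(0,\infty)^2\to\mathbb R$ be measurable, and let $$D_n=\sum_{i=1}^n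 K(X_{[i:n]},X_{[i:n]})\,W_i^2 .$$ (i) If $\int_0^\tau |K(x,x)|\sqrt{\frac{S(x-)}{1-G(x-)}}\,dF(x)<\infty$, then $\sqrt n\,D_n\to 0$ in probability as $n\to\infty$. (ii) If $\int_0^\tau \frac{|K(x,x)|}{1-G(x-)}\,dF(x)<\infty$, then $n\,D_n\to\int_0^\tau \frac{K(x,x)}{1-G(x-)}\,dF(x)$ in probability as $n\to\infty$. -/

import Mathlib

open MeasureTheory ProbabilityTheory Filter Topology

noncomputable section

/-- The observed times `Xᵢ = min(Tᵢ, Cᵢ)`. -/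
def obsTime {Ω : Type*} (T C : ℕ → Ω → ℝ) (i : ℕ) (ω : Ω) : ℝ := min (T i ω) (C i ω)

/-- The censoring indicators `Δᵢ = 1{Tᵢ ≤ Cᵢ}` (`1` means uncensored). -/
def censInd {Ω : Type*} (T C : ℕ → Ω → ℝ) (i : ℕ) (ω : Ω) : ℝ :=
  if T i ω ≤ C i ω then 1 else 0

/-- `1 - F(x-)`, with `F` the distribution function of the probability measure `μ`
and `F(x-)` its left limit. -/
def survLeft (μ : Measure ℝ) (x : ℝ) : ℝ := 1 - Function.leftLim (cdf μ) x

/-- `I_H = {t > 0 : H(t-) < 1}`, with `H` the distribution function of `μ`. It equals `(0, τ]` or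
`(0, τ)`, where `τ = sup {t : 1 - H(t) > 0}`, according to whether `H` jumps at `τ` or not. -/
def obsInterval (μ : Measure ℝ) : Set ℝ := {t | 0 < t ∧ Function.leftLim (cdf μ) t < 1}

/-- `σ` puts the sample `(xᵢ, δᵢ)` in increasing order of the times; where an uncensored and a
censored time are tied, the censored one comes later. All other ties are ordered arbitrarily. -/
def IsKMOrder {n : ℕ} (x δ : Fin n → ℝ) (σ : Equiv.Perm (Fin n)) : Prop :=
  ∀ i j : Fin n, i < j →
    x (σ i) < x (σ j) ∨ (x (σ i) = x (σ j) ∧ δ (σ j) ≤ δ (σ i))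

/-- Every sample has such an ordering. -/
theorem exists_isKMOrder {n : ℕ} (x δ : Fin n → ℝ) : ∃ σ, IsKMOrder x δ σ := by
  refine ⟨Tuple.sort (fun i => toLex (x i, -δ i)), fun i j hij => ?_⟩
  have h := Tuple.monotone_sort (fun i => toLex (x i, -δ i)) hij.le
  simpa [Prod.Lex.toLex_le_toLex] using h

/-- The Kaplan-Meier weight of the `i`-th ordered observation. The positions are numbered from `0`,
so that position `j` here is position `j + 1` in the usual formula
`Wᵢ = (Δ_[i:n] / n) ∏_{j < i} (1 + (1 - Δ_[j:n]) / (n - j))`. -/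
def kmWeight {n : ℕ} (δ : Fin n → ℝ) (σ : Equiv.Perm (Fin n)) (i : Fin n) : ℝ :=
  δ (σ i) / n * ∏ j ∈ Finset.Iio i, (1 + (1 - δ (σ j)) / ((n : ℝ) - ((j : ℕ) + 1)))

/-- The diagonal sum `∑ᵢ K(Xᵢ, Xᵢ) Wᵢ²`, each observation being paired with its own weight. -/
def kmDiag (K : ℝ → ℝ → ℝ) {n : ℕ} (x δ : Fin n → ℝ) (σ : Equiv.Perm (Fin n)) : ℝ :=
  ∑ i : Fin n, K (x (σ i)) (x (σ i)) * kmWeight δ σ i ^ 2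

end

/-!
The Kaplan-Meier weight of an uncensored observation at `x` is `w / n`, where `w` is a product over
the observations censored before `x`, depending only on the other observations. The law of the
sample does not change when the censoring times are permuted among the subjects, and averaging over
these permutations bounds the expectations of such products by those of functions of the number of
censoring times `≥ x`, that is, by binomial expectations. This gives `(1 - G(x-))² E[w²] ≤ 2` and
`w → 1 / (1 - G(x-))` in `L²`. Part (ii) follows by dominated convergence and the law of large
numbers. For part (i) the sum is truncated to the times at which an observation is at risk with
probability greater than `c / n`, which changes it with probability at most `c`.
-/

noncomputable section

open scoped Finset

variable {m : ℕ} {r r' : ℕ → ℝ} {d : ℕ} {x : ℝ} {z : Fin m → ℝ × ℝ}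

/-! ### Risk sets and products over the censored observations -/

/-- The sorting key of the `i`-th of the pairs `(tᵢ, cᵢ)`: observed time, then uncensored before
censored, then index. It is injective, so it turns the Kaplan-Meier order into a strict one. -/
def kmKey (z : Fin m → ℝ × ℝ) (i : Fin m) : ℝ ×ₗ Bool ×ₗ Fin m :=
  toLex (min (z i).1 (z i).2, toLex (decide ((z i).2 < (z i).1), i))

theorem kmKey_injective (z : Fin m → ℝ × ℝ) : Function.Injective (kmKey z) := fun i j h => by
  simp only [kmKey, toLex_inj, Prod.mk.injEq] at h
  exact h.2.2

theorem kmKey_le_kmKey_iff_of_censored {b l : Fin m} (hb : (z b).2 < (z b).1) :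
    kmKey z b ≤ kmKey z l ↔
      (z b).2 < (z l).1 ∧ ((z b).2 < (z l).2 ∨ (z b).2 = (z l).2 ∧ b ≤ l) := by
  simp only [kmKey, Prod.Lex.toLex_le_toLex, min_eq_right hb.le, hb, decide_true]
  rcases lt_or_ge (z l).2 (z l).1 with hl | hl
  · grind
  · simp only [min_eq_left hl, hl.not_gt, decide_false, Bool.lt_iff]
    grind

theorem kmKey_lt_kmKey_iff_of_censored_of_uncensored {a b : Fin m} (hb : (z b).2 < (z b).1)
    (ha : (z a).1 ≤ (z a).2) : kmKey z b < kmKey z a ↔ (z b).2 < (z a).1 := by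
  simp [kmKey, Prod.Lex.toLex_lt_toLex, min_eq_right hb.le, min_eq_left ha, hb, ha.not_gt]

/-- The number of observations that do not precede the `b`-th one in the order of `kmKey`. For a
censored observation this is the number of subjects at risk just before its censoring. -/
def censRisk (z : Fin m → ℝ × ℝ) (b : Fin m) : ℕ := #{l | kmKey z b ≤ kmKey z l}

/-- The number of subjects at risk at `x`. -/
def riskAt (x : ℝ) (z : Fin m → ℝ × ℝ) : ℕ := #{l | x ≤ (z l).1 ∧ x ≤ (z l).2}

/-- The product of `r y` over the observations censored before `x`, with `y` the number of subjects
at risk at the censoring. -/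
def censProd (r : ℕ → ℝ) (x : ℝ) (z : Fin m → ℝ × ℝ) : ℝ :=
  ∏ b, if (z b).2 < (z b).1 ∧ (z b).2 < x then r (censRisk z b) else 1

/-- `censProd`, cut off to `0` where fewer than `d` subjects are at risk at `x`. -/
def censProdCut (r : ℕ → ℝ) (d : ℕ) (x : ℝ) (z : Fin m → ℝ × ℝ) : ℝ :=
  if d ≤ riskAt x z then censProd r x z else 0

theorem censRisk_lt_censRisk {b b' : Fin m} (h : kmKey z b < kmKey z b') :
    censRisk z b' < censRisk z b :=
  Finset.card_lt_card <| Finset.ssubset_iff_of_subset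
    (Finset.monotone_filter_right _ fun _ _ hl => h.le.trans hl) |>.2 ⟨b, by simp, by simp [h]⟩

theorem censRisk_injective (z : Fin m → ℝ × ℝ) : Function.Injective (censRisk z) := fun b b' h => by
  by_contra hne
  rcases lt_or_gt_of_ne ((kmKey_injective z).ne hne) with hlt | hlt
  exacts [(censRisk_lt_censRisk hlt).ne' h, (censRisk_lt_censRisk hlt).ne h]

theorem censRisk_le (z : Fin m → ℝ × ℝ) (b : Fin m) : censRisk z b ≤ m :=
  card_finset_fin_le _

theorem riskAt_le (x : ℝ) (z : Fin m → ℝ × ℝ) : riskAt x z ≤ m :=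
  card_finset_fin_le _

theorem riskAt_lt_censRisk {b : Fin m} (hb : (z b).2 < (z b).1) (hbx : (z b).2 < x) :
    riskAt x z < censRisk z b := by
  refine Finset.card_lt_card (Finset.ssubset_iff_of_subset ?_ |>.2 ⟨b, by simp, by simp [hbx]⟩)
  refine Finset.monotone_filter_right _ fun l _ hl => ?_
  exact (kmKey_le_kmKey_iff_of_censored hb).2 ⟨hbx.trans_le hl.1, .inl (hbx.trans_le hl.2)⟩

theorem censProd_nonneg (hr : ∀ y, 0 ≤ r y) (x : ℝ) (z : Fin m → ℝ × ℝ) : 0 ≤ censProd r x z :=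
  Finset.prod_nonneg fun b _ => by split_ifs; exacts [hr _, zero_le_one]

theorem one_le_censProd (hr : ∀ y, 1 ≤ r y) (x : ℝ) (z : Fin m → ℝ × ℝ) : 1 ≤ censProd r x z :=
  Finset.one_le_prod fun b _ => by split_ifs; exacts [hr _, le_rfl]

theorem censProd_mul (r r' : ℕ → ℝ) (x : ℝ) (z : Fin m → ℝ × ℝ) :
    censProd (r * r') x z = censProd r x z * censProd r' x z := by
  simp only [censProd, ← Finset.prod_mul_distrib, Pi.mul_apply]
  exact Finset.prod_congr rfl fun b _ => by split_ifs <;> simp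

theorem censProd_inv (r : ℕ → ℝ) (x : ℝ) (z : Fin m → ℝ × ℝ) :
    censProd r⁻¹ x z = (censProd r x z)⁻¹ := by
  simp only [censProd, ← Finset.prod_inv_distrib, Pi.inv_apply]
  exact Finset.prod_congr rfl fun b _ => by split_ifs <;> simp

theorem censProd_congr (h : ∀ y, riskAt x z < y → r y = r' y) : censProd r x z = censProd r' x z :=
  Finset.prod_congr rfl fun b _ => by
    split_ifs with hb
    exacts [h _ (riskAt_lt_censRisk hb.1 hb.2), rfl]

theorem censProd_eq_one_of_forall_le (r : ℕ → ℝ) (hx : ∀ b, x ≤ (z b).2) : censProd r x z = 1 :=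
  Finset.prod_eq_one fun b _ => if_neg fun h => (hx b).not_gt h.2

end

noncomputable section

open scoped Finset

variable {m : ℕ} {r : ℕ → ℝ} {d : ℕ} {x : ℝ} {z : Fin m → ℝ × ℝ}

/-! ### Averaging over the assignments of the censoring times -/

theorem card_filter_comp_perm {α : Type*} [Fintype α] (π : Equiv.Perm α) (p : α → Prop)
    [DecidablePred p] : #{l | p (π l)} = #{l | p l} :=
  Finset.card_equiv π (by simp)

theorem card_filter_tail {α : Type*} (z : Fin (m + 1) → α) (p : α → Prop) [DecidablePred p]
    (h0 : ¬ p (z 0)) : #{l | p (Fin.tail z l)} = #{l | p (z l)} := by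
  rw [Fin.card_filter_univ_succ, if_neg h0]; rfl

/-- The number of potential censoring times that are at least `x`. -/
def tailCount (x : ℝ) (c : Fin m → ℝ) : ℕ := #{l | x ≤ c l}

theorem tailCount_le (x : ℝ) (c : Fin m → ℝ) : tailCount x c ≤ m := card_finset_fin_le _

/-- The value that `censProdCut r d x` takes for the censoring times `c` when nobody leaves the
study before `x` except by censoring. -/
def censOnlyProd (r : ℕ → ℝ) (d : ℕ) (x : ℝ) (c : Fin m → ℝ) : ℝ :=
  if d ≤ tailCount x c then ∏ y ∈ Finset.Ioc (tailCount x c) m, r y else 0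

theorem censRisk_comp_sort (z : Fin m → ℝ × ℝ) {b : Fin m}
    (hb : (z (Tuple.sort (fun i => (z i).2) b)).2 < (z (Tuple.sort (fun i => (z i).2) b)).1) :
    censRisk (z ∘ Tuple.sort fun i => (z i).2) b =
      censRisk z (Tuple.sort (fun i => (z i).2) b) := by
  set τ := Tuple.sort fun i => (z i).2 with hτ
  have hstable : ∀ i j, (z (τ i)).2 = (z (τ j)).2 → (i ≤ j ↔ τ i ≤ τ j) := by
    have hlt : ∀ i j, (z (τ i)).2 = (z (τ j)).2 → i < j → τ i < τ j := fun i j h hij =>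
      (Tuple.eq_sort_iff.1 hτ).2 i j hij h
    intro i j h
    refine ⟨fun hij => ?_, fun hij => le_of_not_gt fun hji => (hlt j i h.symm hji).not_ge hij⟩
    rcases hij.eq_or_lt with rfl | hij
    exacts [le_rfl, (hlt i j h hij).le]
  rw [censRisk, censRisk, ← card_filter_comp_perm τ fun l => kmKey z (τ b) ≤ kmKey z l]
  congr! 2 with l
  rw [kmKey_le_kmKey_iff_of_censored hb, kmKey_le_kmKey_iff_of_censored (z := z ∘ τ) hb]
  have := hstable b l
  grind

theorem censProd_comp_sort (r : ℕ → ℝ) (x : ℝ) (z : Fin m → ℝ × ℝ) :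
    censProd r x (z ∘ Tuple.sort fun i => (z i).2) = censProd r x z := by
  rw [censProd, censProd, ← Equiv.prod_comp (Tuple.sort fun i => (z i).2) fun b =>
    if (z b).2 < (z b).1 ∧ (z b).2 < x then r (censRisk z b) else 1]
  refine Finset.prod_congr rfl fun b _ => if_ctx_congr Iff.rfl (fun hb => ?_) fun _ => rfl
  rw [censRisk_comp_sort z hb.1]

theorem censProdCut_comp_sort (r : ℕ → ℝ) (d : ℕ) (x : ℝ) (z : Fin m → ℝ × ℝ) :
    censProdCut r d x (z ∘ Tuple.sort fun i => (z i).2) = censProdCut r d x z := by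
  have h : riskAt x (z ∘ Tuple.sort fun i => (z i).2) = riskAt x z :=
    card_filter_comp_perm _ fun l => x ≤ (z l).1 ∧ x ≤ (z l).2
  rw [censProdCut, censProdCut, censProd_comp_sort, h]

theorem censOnlyProd_comp_perm (r : ℕ → ℝ) (d : ℕ) (x : ℝ) (c : Fin m → ℝ)
    (π : Equiv.Perm (Fin m)) : censOnlyProd r d x (c ∘ π) = censOnlyProd r d x c := by
  have h : tailCount x (c ∘ π) = tailCount x c := card_filter_comp_perm π (x ≤ c ·)
  rw [censOnlyProd, censOnlyProd, h]

theorem censRisk_succ {z : Fin (m + 1) → ℝ × ℝ} (hz : Monotone fun i => (z i).2) {b : Fin m}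
    (hb : (Fin.tail z b).2 < (Fin.tail z b).1) :
    censRisk z b.succ = censRisk (Fin.tail z) b := by
  simp only [censRisk, kmKey_le_kmKey_iff_of_censored hb,
    kmKey_le_kmKey_iff_of_censored (z := z) (b := b.succ) hb]
  rw [Fin.card_filter_univ_succ, if_neg]
  · congr! 2 with l
    simp [Fin.tail]
  · rintro ⟨-, h | ⟨-, h⟩⟩
    exacts [h.not_ge (hz (Fin.zero_le _)), absurd h (by simp)]

theorem censProd_succ (r : ℕ → ℝ) {z : Fin (m + 1) → ℝ × ℝ} (hz : Monotone fun i => (z i).2)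
    (hx : (z 0).2 < x) :
    censProd r x z = (if (z 0).2 < (z 0).1 then r #{l | (z 0).2 < (z l).1} else 1) *
      censProd r x (Fin.tail z) := by
  rw [censProd, Fin.prod_univ_succ]
  congr 1
  · simp only [hx, and_true]
    refine if_ctx_congr Iff.rfl (fun h0 => ?_) fun _ => rfl
    simp only [censRisk, kmKey_le_kmKey_iff_of_censored h0, Fin.zero_le, and_true,
      ← le_iff_lt_or_eq]
    congr! 3 with l
    exact and_iff_left (hz (Fin.zero_le l))
  · refine Finset.prod_congr rfl fun b _ => if_ctx_congr Iff.rfl (fun hb => ?_) fun _ => rfl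
    rw [censRisk_succ hz hb.1]

theorem censProdCut_succ (r : ℕ → ℝ) (d : ℕ) {z : Fin (m + 1) → ℝ × ℝ}
    (hz : Monotone fun i => (z i).2) (hx : (z 0).2 < x) :
    censProdCut r d x z = (if (z 0).2 < (z 0).1 then r #{l | (z 0).2 < (z l).1} else 1) *
      censProdCut r d x (Fin.tail z) := by
  have h : riskAt x (Fin.tail z) = riskAt x z :=
    card_filter_tail z (fun p => x ≤ p.1 ∧ x ≤ p.2) fun h => h.2.not_gt hx
  rw [censProdCut, censProdCut, h, censProd_succ r hz hx, mul_ite, mul_zero]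

theorem censOnlyProd_succ (r : ℕ → ℝ) (d : ℕ) {c : Fin (m + 1) → ℝ} (hx : c 0 < x) :
    censOnlyProd r d x c = r (m + 1) * censOnlyProd r d x (Fin.tail c) := by
  have h : tailCount x (Fin.tail c) = tailCount x c := card_filter_tail c (x ≤ ·) hx.not_ge
  have hle : tailCount x c ≤ m := h ▸ tailCount_le x _
  rw [censOnlyProd, censOnlyProd, h, ← Finset.insert_Ioc_right_eq_Ioc_add_one hle,
    Finset.prod_insert (by simp), mul_ite, mul_zero]

theorem censOnlyProd_nonneg (hr : ∀ y, 0 ≤ r y) (d : ℕ) (x : ℝ) (c : Fin m → ℝ) :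
    0 ≤ censOnlyProd r d x c := by
  unfold censOnlyProd; split_ifs; exacts [Finset.prod_nonneg fun y _ => hr y, le_rfl]

theorem censProdCut_le_censOnlyProd_of_forall_le (r : ℕ → ℝ) (d : ℕ)
    (hx : ∀ b, x ≤ (z b).2) : censProdCut r d x z ≤ censOnlyProd r d x fun i => (z i).2 := by
  have h : tailCount x (fun i => (z i).2) = m := by simp [tailCount, hx]
  rw [censProdCut, censOnlyProd, censProd_eq_one_of_forall_le r hx, h]
  have := riskAt_le x z
  split_ifs <;> first | omega | simp

theorem sum_perm_succ_le {f : Equiv.Perm (Fin (m + 1)) → ℝ} {w : Fin (m + 1) → ℝ}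
    {g : (Fin m → Fin (m + 1)) → ℝ} {A B : ℝ} (hw : ∀ p, 0 ≤ w p)
    (hf : ∀ π, f π = w (π 0) * g fun l => π l.succ) (hA : ∑ p, w p ≤ A) (hB : 0 ≤ B)
    (hg : ∀ p, ∑ e : Equiv.Perm (Fin m), g (fun l => Equiv.swap 0 p (e l).succ) ≤ B) :
    ∑ π, f π ≤ A * B := by
  rw [← Equiv.sum_comp Equiv.Perm.decomposeFin.symm, Fintype.sum_prod_type]
  simp_rw [hf, Equiv.Perm.decomposeFin_symm_apply_zero, Equiv.Perm.decomposeFin_symm_apply_succ,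
    ← Finset.mul_sum]
  calc ∑ p, w p * ∑ e : Equiv.Perm (Fin m), g (fun l => Equiv.swap 0 p (e l).succ)
      ≤ ∑ p, w p * B := Finset.sum_le_sum fun p _ => mul_le_mul_of_nonneg_left (hg p) (hw p)
    _ = (∑ p, w p) * B := Finset.sum_mul .. |>.symm
    _ ≤ A * B := mul_le_mul_of_nonneg_right hA hB

theorem sum_ite_le_of_monotoneOn (hr : MonotoneOn (fun y : ℕ => (y : ℝ) * (r y - 1)) (Set.Ici d))
    (p : Fin m → Prop) [DecidablePred p] (hd : d ≤ #{l | p l}) :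
    ∑ l, (if p l then r #{l | p l} else 1) ≤ m * r m := by
  have hle : #{l | p l} ≤ m := card_finset_fin_le _
  have hmono := hr hd (hd.trans hle) hle
  have hcard : (#{l | p l} : ℝ) + #{l | ¬ p l} = m := by
    exact_mod_cast (Finset.card_filter_add_card_filter_not (s := Finset.univ) p).trans (by simp)
  rw [Finset.sum_ite, Finset.sum_const, Finset.sum_const, nsmul_eq_mul, nsmul_eq_mul]
  simp only at hmono
  linarith

/-- The first subject in the order of the censoring times is censored at risk size `y` with
probability `y / (m + 1)`, so it contributes the factor `1 + y * (r y - 1) / (m + 1)` on average,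
which is at most `r (m + 1)`. -/
theorem sum_perm_censProdCut_le_of_monotone (hr0 : ∀ y, 0 ≤ r y)
    (hr : MonotoneOn (fun y : ℕ => (y : ℝ) * (r y - 1)) (Set.Ici d)) (t : Fin m → ℝ)
    {c : Fin m → ℝ} (hc : Monotone c) :
    ∑ π : Equiv.Perm (Fin m), censProdCut r d x (fun i => (t (π i), c i)) ≤
      m.factorial * censOnlyProd r d x c := by
  induction m with
  | zero => simp [censProdCut, censProd, riskAt, censOnlyProd, tailCount]
  | succ m ih =>
    rcases le_or_gt x (c 0) with hx | hx
    · refine (Finset.sum_le_card_nsmul _ _ (censOnlyProd r d x c) fun π _ => ?_).trans (by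
        simp [Fintype.card_perm])
      exact censProdCut_le_censOnlyProd_of_forall_le r d fun b => hx.trans (hc (Fin.zero_le b))
    have hcard (π : Equiv.Perm (Fin (m + 1))) : #{l | c 0 < t (π l)} = #{l | c 0 < t l} :=
      card_filter_comp_perm π (c 0 < t ·)
    have htail := ih (c := Fin.tail c) (hc := hc.comp Fin.strictMono_succ.monotone)
    have hB := censOnlyProd_nonneg hr0 d x (Fin.tail c)
    have hrhs : ((m + 1).factorial : ℝ) * censOnlyProd r d x c =
        ((m + 1 : ℕ) * r (m + 1)) * (m.factorial * censOnlyProd r d x (Fin.tail c)) := by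
      rw [censOnlyProd_succ r d hx, Nat.factorial_succ]; push_cast; ring
    rw [hrhs]
    rcases le_or_gt d #{l | c 0 < t l} with hd | hd
    · refine sum_perm_succ_le (w := fun p => if c 0 < t p then r #{l | c 0 < t l} else 1)
        (g := fun e => censProdCut r d x fun l => (t (e l), Fin.tail c l))
        (fun p => by split_ifs; exacts [hr0 _, zero_le_one]) (fun π => ?_)
        (sum_ite_le_of_monotoneOn hr _ hd) (by positivity)
        fun p => htail fun l => t (Equiv.swap 0 p l.succ)
      rw [censProdCut_succ r d hc hx, ← hcard π]; rfl
    · refine (Finset.sum_eq_zero fun π _ => if_neg ?_).trans_le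
        (mul_nonneg (mul_nonneg (Nat.cast_nonneg _) (hr0 _)) (by positivity))
      refine not_le.2 (lt_of_le_of_lt ?_ (hcard π ▸ hd))
      exact Finset.card_le_card (Finset.monotone_filter_right _ fun l _ hl => hx.trans_le hl.1)

theorem sum_perm_censProdCut_le (hr0 : ∀ y, 0 ≤ r y)
    (hr : MonotoneOn (fun y : ℕ => (y : ℝ) * (r y - 1)) (Set.Ici d)) (x : ℝ) (t c : Fin m → ℝ) :
    ∑ π : Equiv.Perm (Fin m), censProdCut r d x (fun i => (t (π i), c i)) ≤
      m.factorial * censOnlyProd r d x c := by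
  calc ∑ π : Equiv.Perm (Fin m), censProdCut r d x (fun i => (t (π i), c i))
      = ∑ π : Equiv.Perm (Fin m),
          censProdCut r d x (fun i => (t (π (Tuple.sort c i)), c (Tuple.sort c i))) :=
        Finset.sum_congr rfl fun π _ =>
          (censProdCut_comp_sort r d x fun i => (t (π i), c i)).symm
    _ = ∑ π : Equiv.Perm (Fin m), censProdCut r d x (fun i => (t (π i), (c ∘ Tuple.sort c) i)) :=
        Equiv.sum_comp (Equiv.mulRight (Tuple.sort c)) fun π =>
          censProdCut r d x fun i => (t (π i), (c ∘ Tuple.sort c) i)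
    _ ≤ m.factorial * censOnlyProd r d x (c ∘ Tuple.sort c) :=
        sum_perm_censProdCut_le_of_monotone hr0 hr t (Tuple.monotone_sort c)
    _ = m.factorial * censOnlyProd r d x c := by rw [censOnlyProd_comp_perm]

end

noncomputable section

variable {m : ℕ} {r r' : ℕ → ℝ} {x : ℝ} {z : Fin m → ℝ × ℝ}

/-! ### Comparing products over the censored observations -/

theorem censProd_le_prod_Ioc (hr : ∀ y, riskAt x z < y → 1 ≤ r y) :
    censProd r x z ≤ ∏ y ∈ Finset.Ioc (riskAt x z) m, r y := by
  rw [censProd, ← Finset.prod_filter, ← Finset.prod_image (f := r) (censRisk_injective z).injOn]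
  have hsub : (Finset.univ.filter fun b => (z b).2 < (z b).1 ∧ (z b).2 < x).image (censRisk z) ⊆
      Finset.Ioc (riskAt x z) m := by
    simp only [Finset.image_subset_iff, Finset.mem_filter, Finset.mem_univ, true_and,
      Finset.mem_Ioc]
    exact fun b hb => ⟨riskAt_lt_censRisk hb.1 hb.2, censRisk_le z b⟩
  exact Finset.prod_le_prod_of_subset_of_one_le hsub
    (fun y hy => zero_le_one.trans (hr y (Finset.mem_Ioc.1 (hsub hy)).1))
    fun y hy _ => hr y (Finset.mem_Ioc.1 hy).1

theorem prod_Ioc_eq_div {f g : ℕ → ℝ} {k n : ℕ} (hkn : k ≤ n) (hg : ∀ y, k ≤ y → g y ≠ 0)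
    (h : ∀ y, k ≤ y → f (y + 1) * g y = g (y + 1)) : ∏ y ∈ Finset.Ioc k n, f y = g n / g k := by
  induction n, hkn using Nat.le_induction with
  | base => simp [hg k le_rfl]
  | succ n hn ih =>
    rw [← Finset.insert_Ioc_right_eq_Ioc_add_one hn, Finset.prod_insert (by simp), ih, ← h n hn,
      mul_div_assoc]

/-- The quotients of `r` by `r'` telescope, because the risk sizes at the censored observations are
distinct. -/
theorem censProd_le_div {g : ℕ → ℝ} (hr' : ∀ y, 0 ≤ r' y) (hg : ∀ y, riskAt x z ≤ y → 0 < g y)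
    (hmono : ∀ y, g y ≤ g (y + 1)) (hg1 : ∀ y, g y ≤ 1)
    (h : ∀ y, riskAt x z ≤ y → r (y + 1) * g y = r' (y + 1) * g (y + 1)) :
    censProd r x z ≤ censProd r' x z / g (riskAt x z) := by
  set q : ℕ → ℝ := fun y => g y / g (y - 1)
  have hfactor : censProd r x z = censProd r' x z * censProd q x z := by
    rw [← censProd_mul]
    refine censProd_congr fun y hy => ?_
    obtain ⟨y, rfl⟩ := Nat.exists_eq_add_one_of_ne_zero (Nat.ne_zero_of_lt hy)
    rw [Pi.mul_apply, ← mul_div_assoc, Nat.add_sub_cancel, ← h y (by omega),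
      mul_div_cancel_right₀ _ (hg y (by omega)).ne']
  have hq : censProd q x z ≤ 1 / g (riskAt x z) := by
    refine (censProd_le_prod_Ioc fun y hy => ?_).trans ?_
    · obtain ⟨y, rfl⟩ := Nat.exists_eq_add_one_of_ne_zero (Nat.ne_zero_of_lt hy)
      exact (one_le_div (hg y (by omega))).2 (hmono y)
    · rw [prod_Ioc_eq_div (riskAt_le x z) (fun y hy => (hg y hy).ne') fun y hy =>
        div_mul_cancel₀ _ (hg y hy).ne']
      exact div_le_div_of_nonneg_right (hg1 m) (hg _ le_rfl).le
  rw [hfactor, div_eq_mul_one_div (censProd r' x z)]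
  exact mul_le_mul_of_nonneg_left hq (censProd_nonneg hr' x z)

/-- The factor `1 + κ / y`, with value `1` at `y = 0`. -/
def riskFactor (κ : ℝ) (y : ℕ) : ℝ := 1 + κ / y

theorem riskFactor_nonneg {κ : ℝ} (hκ : -1 ≤ κ) (y : ℕ) : 0 ≤ riskFactor κ y := by
  rcases Nat.eq_zero_or_pos y with rfl | hy
  · simp [riskFactor]
  have hy : (1 : ℝ) ≤ y := by exact_mod_cast hy
  have : -1 ≤ κ / y := by rw [le_div_iff₀ (by positivity)]; linarith
  rw [riskFactor]; linarith

theorem one_le_riskFactor {κ : ℝ} (hκ : 0 ≤ κ) (y : ℕ) : 1 ≤ riskFactor κ y :=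
  le_add_of_nonneg_right (by positivity)

theorem monotoneOn_cast_mul_riskFactor_sub_one (κ : ℝ) :
    MonotoneOn (fun y : ℕ => (y : ℝ) * (riskFactor κ y - 1)) (Set.Ici 1) := by
  have h : Set.EqOn (fun _ => κ) (fun y : ℕ => (y : ℝ) * (riskFactor κ y - 1)) (Set.Ici 1) :=
    fun y hy => by
      have : (y : ℝ) ≠ 0 := by exact_mod_cast Nat.one_le_iff_ne_zero.1 hy
      simp only [riskFactor]; field_simp; ring
  exact monotoneOn_const.congr h

theorem monotone_cast_mul_riskFactor_sub_one {κ : ℝ} (hκ : 0 ≤ κ) :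
    Monotone fun y : ℕ => (y : ℝ) * (riskFactor κ y - 1) := by
  refine monotone_nat_of_le_succ fun y => ?_
  rcases Nat.eq_zero_or_pos y with rfl | hy
  · simpa [riskFactor] using hκ
  · exact monotoneOn_cast_mul_riskFactor_sub_one κ hy (Nat.le_add_left 1 y) y.le_succ

/-- `n w` for the Kaplan-Meier weight `w` of an uncensored observation at `x` that is added to the
sample `z`, where `n` is the size of the enlarged sample (see `kmWeight_eq_relWeight`). -/
def relWeight (x : ℝ) (z : Fin m → ℝ × ℝ) : ℝ := censProd (riskFactor 1) x z

theorem one_le_relWeight (x : ℝ) (z : Fin m → ℝ × ℝ) : 1 ≤ relWeight x z :=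
  one_le_censProd (one_le_riskFactor zero_le_one) x z

theorem relWeight_sq (x : ℝ) (z : Fin m → ℝ × ℝ) :
    relWeight x z ^ 2 = censProd (riskFactor 1 * riskFactor 1) x z := by
  rw [censProd_mul, sq, relWeight]

theorem relWeight_inv (x : ℝ) (z : Fin m → ℝ × ℝ) :
    (relWeight x z)⁻¹ = censProd (riskFactor 1)⁻¹ x z := (censProd_inv _ x z).symm

theorem relWeight_sq_le (x : ℝ) (z : Fin m → ℝ × ℝ) :
    relWeight x z ^ 2 ≤ censProd (riskFactor 2) x z * (1 + 1 / (riskAt x z + 1)) := by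
  rw [relWeight_sq]
  refine (censProd_le_div (g := fun y => ((y : ℝ) + 1) / (y + 2))
    (riskFactor_nonneg (κ := 2) (by norm_num)) (fun y _ => by positivity) (fun y => ?_)
    (fun y => ?_) fun y _ => ?_).trans_eq ?_
  · rw [div_le_div_iff₀ (by positivity) (by positivity)]; push_cast; nlinarith
  · rw [div_le_one (by positivity)]; linarith
  · simp only [Pi.mul_apply, riskFactor]; push_cast; field_simp; ring
  · field_simp; ring

theorem censProd_riskFactor_two_sq_le (x : ℝ) (z : Fin m → ℝ × ℝ) :
    censProd (riskFactor 2) x z ^ 2 ≤ 6 * censProd (riskFactor 4) x z := by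
  have h4 := censProd_nonneg (riskFactor_nonneg (κ := 4) (by norm_num)) x z
  rw [sq, ← censProd_mul]
  refine (censProd_le_div (g := fun y => ((y : ℝ) + 1) * (y + 2) / ((y + 3) * (y + 4)))
    (riskFactor_nonneg (κ := 4) (by norm_num)) (fun y _ => by positivity) (fun y => ?_)
    (fun y => ?_) fun y _ => ?_).trans ?_
  · have : (0 : ℝ) ≤ y := y.cast_nonneg
    rw [div_le_div_iff₀ (by positivity) (by positivity)]
    push_cast
    have : 0 ≤ ((y : ℝ) + 2) * (y + 4) * (4 * y + 12) := by positivity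
    nlinarith
  · rw [div_le_one (by positivity)]; nlinarith
  · simp only [Pi.mul_apply, riskFactor]; push_cast; field_simp; ring
  · rw [div_le_iff₀ (by positivity), mul_right_comm]
    refine le_mul_of_one_le_left h4 ?_
    rw [← mul_div_assoc, one_le_div (by positivity)]
    nlinarith [(riskAt x z).cast_nonneg (α := ℝ)]

theorem inv_relWeight_le (x : ℝ) (z : Fin m → ℝ × ℝ) :
    (relWeight x z)⁻¹ ≤ censProdCut (riskFactor (-1)) 1 x z + 2 / (riskAt x z + 1) := by
  rw [censProdCut]
  split_ifs with hY
  · have hle : censProd (riskFactor (-1)) x z ≤ 1 := by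
      refine Finset.prod_le_one (fun b _ => ?_) fun b _ => ?_
      · split_ifs; exacts [riskFactor_nonneg le_rfl _, zero_le_one]
      · split_ifs
        exacts [add_le_of_nonpos_right (div_nonpos_of_nonpos_of_nonneg (by simp) (by simp)), le_rfl]
    rw [relWeight_inv]
    refine (censProd_le_div (g := fun y => (y : ℝ) / (y + 1)) (riskFactor_nonneg (κ := -1) le_rfl)
      (fun y hy => ?_) (fun y => ?_) (fun y => ?_) fun y hy => ?_).trans ?_
    · have : 0 < y := hY.trans hy
      positivity
    · rw [div_le_div_iff₀ (by positivity) (by positivity)]; push_cast; nlinarith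
    · rw [div_le_one (by positivity)]; linarith
    · have : 0 < y := hY.trans hy
      simp only [Pi.inv_apply, riskFactor]; push_cast; field_simp; ring
    · have hY : (1 : ℝ) ≤ riskAt x z := by exact_mod_cast hY
      calc censProd (riskFactor (-1)) x z / (riskAt x z / (riskAt x z + 1))
          = censProd (riskFactor (-1)) x z + censProd (riskFactor (-1)) x z / riskAt x z := by
            field_simp
        _ ≤ censProd (riskFactor (-1)) x z + 1 / riskAt x z := by gcongr
        _ ≤ censProd (riskFactor (-1)) x z + 2 / (riskAt x z + 1) := by
            gcongr 1
            rw [div_le_div_iff₀ (by positivity) (by positivity)]; linarith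
  · rw [Nat.lt_one_iff.1 (not_le.1 hY)]
    have := inv_le_one_of_one_le₀ (one_le_relWeight x z)
    norm_num
    linarith

end

noncomputable section

open scoped Finset

variable {m n : ℕ} {z : Fin m → ℝ × ℝ}

/-! ### The Kaplan-Meier weights as leave-one-out products -/

/-- The observed times of the sample `z` of pairs (lifetime, censoring time). -/
def sampleTime (z : Fin m → ℝ × ℝ) (i : Fin m) : ℝ := min (z i).1 (z i).2

/-- The censoring indicators of the sample `z` of pairs (lifetime, censoring time). -/
def sampleInd (z : Fin m → ℝ × ℝ) (i : Fin m) : ℝ := if (z i).1 ≤ (z i).2 then 1 else 0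

theorem sampleInd_of_censored {i : Fin m} (hi : (z i).2 < (z i).1) : sampleInd z i = 0 :=
  if_neg hi.not_ge

theorem sampleInd_of_uncensored {i : Fin m} (hi : (z i).1 ≤ (z i).2) : sampleInd z i = 1 :=
  if_pos hi

theorem kmDiag_eq_of_isKMOrder (K : ℝ → ℝ → ℝ) {x δ : Fin n → ℝ} {σ τ : Equiv.Perm (Fin n)}
    (hσ : IsKMOrder x δ σ) (hτ : IsKMOrder x δ τ) : kmDiag K x δ σ = kmDiag K x δ τ := by
  have hmono {π : Equiv.Perm (Fin n)} (hπ : IsKMOrder x δ π) :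
      Monotone ((fun i => toLex (x i, -δ i)) ∘ π) :=
    monotone_iff_forall_lt.2 fun i j hij => by simpa [Prod.Lex.toLex_le_toLex] using hπ i j hij
  have h i := congrFun (Tuple.unique_monotone (hmono hσ) (hmono hτ)) i
  simp only [Function.comp, toLex_inj, Prod.mk.injEq, neg_inj] at h
  simp only [kmDiag, kmWeight, (h _).1, (h _).2]

theorem isKMOrder_sort_kmKey (z : Fin m → ℝ × ℝ) :
    IsKMOrder (sampleTime z) (sampleInd z) (Tuple.sort (kmKey z)) := fun i j hij => by
  have h := Tuple.monotone_sort (kmKey z) hij.le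
  simp only [Function.comp, kmKey, Prod.Lex.toLex_le_toLex] at h
  refine h.imp_right fun ⟨htime, h⟩ => ⟨htime, ?_⟩
  unfold sampleInd
  split_ifs with hj hi
  · rfl
  · simp [not_le.1 hi, hj.not_gt, Bool.lt_iff] at h
  · exact zero_le_one
  · rfl

theorem val_add_censRisk_sort (z : Fin m → ℝ × ℝ) (j : Fin m) :
    (j : ℕ) + censRisk z (Tuple.sort (kmKey z) j) = m := by
  have hmono : StrictMono (kmKey z ∘ Tuple.sort (kmKey z)) :=
    (Tuple.monotone_sort _).strictMono_of_injective ((kmKey_injective z).comp (Equiv.injective _))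
  have h : censRisk z (Tuple.sort (kmKey z) j) = #(Finset.Ici j) :=
    Finset.card_equiv (Tuple.sort (kmKey z)).symm fun l => by
      simpa using hmono.le_iff_le (a := j) (b := (Tuple.sort (kmKey z)).symm l)
  rw [h, Fin.card_Ici]
  omega

theorem kmWeight_sort_kmKey (z : Fin m → ℝ × ℝ) (a : Fin m) :
    kmWeight (sampleInd z) (Tuple.sort (kmKey z)) ((Tuple.sort (kmKey z)).symm a) =
      sampleInd z a / m *
        ∏ b, if kmKey z b < kmKey z a then 1 + (1 - sampleInd z b) / (censRisk z b - 1) else 1 := by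
  set σ := Tuple.sort (kmKey z)
  have hmono : StrictMono (kmKey z ∘ σ) :=
    (Tuple.monotone_sort _).strictMono_of_injective ((kmKey_injective z).comp σ.injective)
  rw [kmWeight, Equiv.apply_symm_apply, ← Finset.prod_filter]
  congr 1
  refine Finset.prod_equiv σ (fun j => ?_) fun j _ => ?_
  · simpa using (hmono.lt_iff_lt (a := j) (b := σ.symm a)).symm
  · have h : ((j : ℕ) : ℝ) + censRisk z (σ j) = m := by exact_mod_cast val_add_censRisk_sort z j
    rw [← h]; ring_nf

theorem censRisk_succAbove {z : Fin (m + 1) → ℝ × ℝ} {a : Fin (m + 1)} {b : Fin m}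
    (h : kmKey z (a.succAbove b) < kmKey z a) :
    censRisk z (a.succAbove b) = censRisk (a.removeNth z) b + 1 := by
  have hkey (l : Fin m) : kmKey (a.removeNth z) b ≤ kmKey (a.removeNth z) l ↔
      kmKey z (a.succAbove b) ≤ kmKey z (a.succAbove l) := by
    simp only [kmKey, Prod.Lex.toLex_le_toLex, Fin.succAbove_le_succAbove_iff, Fin.removeNth]
    rfl
  simp only [censRisk, Finset.card_filter, Fin.sum_univ_succAbove _ a, h.le, if_true, hkey,
    add_comm]

theorem kmWeight_eq_relWeight (z : Fin (m + 1) → ℝ × ℝ) {a : Fin (m + 1)}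
    (ha : (z a).1 ≤ (z a).2) :
    kmWeight (sampleInd z) (Tuple.sort (kmKey z)) ((Tuple.sort (kmKey z)).symm a) =
      relWeight (z a).1 (a.removeNth z) / (m + 1) := by
  rw [kmWeight_sort_kmKey, sampleInd_of_uncensored ha, Fin.prod_univ_succAbove _ a,
    if_neg (lt_irrefl _), one_mul, one_div, mul_comm, ← div_eq_mul_inv, relWeight, censProd]
  push_cast
  congr 1
  refine Finset.prod_congr rfl fun b _ => ?_
  rw [Fin.removeNth_apply]
  rcases lt_or_ge (z (a.succAbove b)).2 (z (a.succAbove b)).1 with hb | hb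
  · have hiff := kmKey_lt_kmKey_iff_of_censored_of_uncensored hb ha
    simp only [hiff, hb, true_and, sampleInd_of_censored hb]
    refine if_ctx_congr Iff.rfl (fun hlt => ?_) fun _ => rfl
    rw [censRisk_succAbove (hiff.2 hlt), riskFactor]
    push_cast; ring_nf
  · simp [sampleInd_of_uncensored hb, hb.not_gt]

/-- The sum of `f x y` over the uncensored observations of the sample `z`, where `x` is the observed
time and `y` the sample formed by the remaining observations. -/
def uncensoredSum {β : Type*} [AddCommMonoid β] (f : ℝ → (Fin m → ℝ × ℝ) → β)
    (z : Fin (m + 1) → ℝ × ℝ) : β :=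
  ∑ a, if (z a).1 ≤ (z a).2 then f (z a).1 (a.removeNth z) else 0

theorem uncensoredSum_add {β : Type*} [AddCommMonoid β] (f f' : ℝ → (Fin m → ℝ × ℝ) → β)
    (z : Fin (m + 1) → ℝ × ℝ) :
    uncensoredSum (fun x y => f x y + f' x y) z = uncensoredSum f z + uncensoredSum f' z := by
  rw [uncensoredSum, uncensoredSum, uncensoredSum, ← Finset.sum_add_distrib]
  refine Finset.sum_congr rfl fun a _ => ?_
  split_ifs <;> simp

theorem mul_uncensoredSum (c : ℝ) (f : ℝ → (Fin m → ℝ × ℝ) → ℝ) (z : Fin (m + 1) → ℝ × ℝ) :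
    c * uncensoredSum f z = uncensoredSum (fun x y => c * f x y) z := by
  simp only [uncensoredSum, Finset.mul_sum, mul_ite, mul_zero]

theorem kmDiag_eq_uncensoredSum (K : ℝ → ℝ → ℝ) (z : Fin (m + 1) → ℝ × ℝ)
    {σ : Equiv.Perm (Fin (m + 1))} (hσ : IsKMOrder (sampleTime z) (sampleInd z) σ) :
    kmDiag K (sampleTime z) (sampleInd z) σ =
      uncensoredSum (fun x y => K x x * (relWeight x y / (m + 1)) ^ 2) z := by
  rw [kmDiag_eq_of_isKMOrder K hσ (isKMOrder_sort_kmKey z), kmDiag,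
    ← Equiv.sum_comp (Tuple.sort (kmKey z)).symm, uncensoredSum]
  refine Finset.sum_congr rfl fun a _ => ?_
  rw [Equiv.apply_symm_apply]
  split_ifs with ha
  · rw [kmWeight_eq_relWeight z ha, sampleTime, min_eq_left ha]
  · rw [kmWeight_sort_kmKey, sampleInd_of_censored (not_le.1 ha), zero_div, zero_mul]
    ring

end

noncomputable section

open scoped Finset

/-! ### Binomial counts -/

section Binomial

variable {α : Type*} [MeasurableSpace α] (ν : Measure α) [IsProbabilityMeasure ν] {A : Set α}
  [DecidablePred (· ∈ A)]

theorem measureReal_pi_setOf_filter_mem_eq (hA : MeasurableSet A) {m : ℕ} (s : Finset (Fin m)) :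
    (Measure.pi fun _ : Fin m => ν).real {z | ({l | z l ∈ A} : Finset (Fin m)) = s} =
      ν.real A ^ #s * (1 - ν.real A) ^ (m - #s) := by
  have hset : {z : Fin m → α | ({l | z l ∈ A} : Finset (Fin m)) = s} =
      Set.univ.pi fun l => if l ∈ s then A else Aᶜ := by
    ext z
    simp only [Set.mem_ofPred_eq, Finset.ext_iff, Finset.mem_filter_univ, Set.mem_univ_pi]
    exact forall_congr' fun l => by split_ifs with hl <;> simp [hl]
  have hcoord : ∀ l, ν.real (if l ∈ s then A else Aᶜ) =
      if l ∈ s then ν.real A else 1 - ν.real A := fun l => by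
    split_ifs
    exacts [rfl, probReal_compl_eq_one_sub hA]
  rw [hset, measureReal_def, Measure.pi_pi, ENNReal.toReal_prod]
  simp only [← measureReal_def, hcoord, Finset.prod_ite, Finset.prod_const]
  simp [Finset.filter_not, ← Finset.compl_eq_univ_sdiff, Finset.card_compl]

theorem integral_card_filter_mem (hA : MeasurableSet A) {m : ℕ} (f : ℕ → ℝ) :
    ∫ z, f #{l | z l ∈ A} ∂(Measure.pi fun _ : Fin m => ν) =
      ∑ b ∈ Finset.range (m + 1),
        m.choose b • (f b * (ν.real A ^ b * (1 - ν.real A) ^ (m - b))) := by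
  have hsum : ∀ z : Fin m → α, f #{l | z l ∈ A} = ∑ s ∈ (Finset.univ : Finset (Fin m)).powerset,
      {z | ({l | z l ∈ A} : Finset (Fin m)) = s}.indicator (fun _ => f #s) z := fun z => by
    simp [Set.indicator_apply]
  have hmeas : ∀ s : Finset (Fin m),
      MeasurableSet {z : Fin m → α | ({l | z l ∈ A} : Finset (Fin m)) = s} := fun s => by
    have hset : {z : Fin m → α | ({l | z l ∈ A} : Finset (Fin m)) = s} =
        ⋂ l, {z | z l ∈ A ↔ l ∈ s} := by
      ext z; simp [Finset.ext_iff]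
    rw [hset]
    exact .iInter fun l => ((measurable_pi_apply l) hA).iff (.const _)
  simp_rw [hsum]
  rw [integral_finsetSum _ fun s _ => (integrable_const _).indicator (hmeas s)]
  simp_rw [integral_indicator_const _ (hmeas _), measureReal_pi_setOf_filter_mem_eq ν hA,
    smul_eq_mul, mul_comm _ (f _)]
  rw [Finset.sum_powerset_apply_card fun b => f b * (ν.real A ^ b * (1 - ν.real A) ^ (m - b))]
  simp

theorem choose_mul_choose_div_choose (m k b : ℕ) :
    (m.choose b : ℝ) * ((m + k).choose m / (b + k).choose b) = (m + k).choose (b + k) := by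
  have hnat : (m + k).choose (b + k) * (b + k).choose b = (m + k).choose m * m.choose b := by
    rw [Nat.choose_symm_add, Nat.choose_symm_add, Nat.choose_mul (Nat.le_add_left k b)]
    simp
  have hpos : ((b + k).choose b : ℝ) ≠ 0 := by
    exact_mod_cast (Nat.choose_pos (Nat.le_add_right b k)).ne'
  rw [← mul_div_assoc, div_eq_iff hpos, mul_comm]
  exact_mod_cast hnat.symm

theorem pow_mul_integral_choose_div_choose_le (hA : MeasurableSet A) (m k : ℕ) :
    ν.real A ^ k * ∫ z, ((m + k).choose m : ℝ) /
      ((#{l | z l ∈ A} + k).choose #{l | z l ∈ A}) ∂(Measure.pi fun _ : Fin m => ν) ≤ 1 := by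
  rw [integral_card_filter_mem ν hA fun b => ((m + k).choose m : ℝ) / ((b + k).choose b),
    Finset.mul_sum]
  set p := ν.real A
  have hp1 : 0 ≤ 1 - p := sub_nonneg.2 measureReal_le_one
  set g : ℕ → ℝ := fun b => p ^ b * (1 - p) ^ (m + k - b) * (m + k).choose b
  calc _ = ∑ b ∈ Finset.range (m + 1), g (k + b) := by
        refine Finset.sum_congr rfl fun b _ => ?_
        simp only [g, add_comm k b, Nat.add_sub_add_right, ← choose_mul_choose_div_choose,
          nsmul_eq_mul]
        ring
    _ ≤ ∑ b ∈ Finset.range (k + (m + 1)), g b := by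
        rw [Finset.sum_range_add g k]
        exact le_add_of_nonneg_left (Finset.sum_nonneg fun b _ => by positivity)
    _ = 1 := by
        rw [show k + (m + 1) = m + k + 1 by ring, ← add_pow]
        simp

end Binomial

end

noncomputable section

open scoped Finset

variable {m : ℕ}

/-! ### Moments under the product law -/

theorem measurable_card_filter {α β : Type*} [MeasurableSpace α] [Fintype β] {p : α → β → Prop}
    [∀ a, DecidablePred (p a)] (hp : ∀ b, MeasurableSet {a | p a b}) :
    Measurable fun a => #{b | p a b} := by
  simp_rw [Finset.card_filter]
  exact Finset.measurable_sum _ fun b _ => .ite (hp b) measurable_const measurable_const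

theorem measurableSet_setOf_kmKey_le_kmKey (b l : Fin m) :
    MeasurableSet {z : Fin m → ℝ × ℝ | kmKey z b ≤ kmKey z l} := by
  simp only [kmKey, Prod.Lex.toLex_le_toLex, Bool.lt_iff, decide_eq_false_iff_not,
    decide_eq_true_eq, decide_eq_decide]
  measurability

theorem measurable_censRisk (b : Fin m) : Measurable fun z : Fin m → ℝ × ℝ => censRisk z b :=
  measurable_card_filter (measurableSet_setOf_kmKey_le_kmKey b)

theorem measurable_riskAt (m : ℕ) : Measurable fun p : ℝ × (Fin m → ℝ × ℝ) => riskAt p.1 p.2 :=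
  measurable_card_filter fun l => by measurability

theorem measurable_tailCount (x : ℝ) (m : ℕ) : Measurable (tailCount x : (Fin m → ℝ) → ℕ) :=
  measurable_card_filter fun l => by measurability

theorem measurable_censProd (r : ℕ → ℝ) (m : ℕ) :
    Measurable fun p : ℝ × (Fin m → ℝ × ℝ) => censProd r p.1 p.2 :=
  Finset.measurable_prod _ fun b _ => .ite (by measurability)
    (measurable_from_top.comp ((measurable_censRisk b).comp measurable_snd)) measurable_const

theorem abs_censProd_le (r : ℕ → ℝ) (x : ℝ) (z : Fin m → ℝ × ℝ) :
    |censProd r x z| ≤ (1 + ∑ y ∈ Finset.range (m + 1), |r y|) ^ m := by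
  have hsum : 0 ≤ ∑ y ∈ Finset.range (m + 1), |r y| := Finset.sum_nonneg fun _ _ => abs_nonneg _
  rw [censProd, Finset.abs_prod]
  refine (Finset.prod_le_prod (fun _ _ => abs_nonneg _) fun b _ => ?_).trans_eq
    ((Finset.prod_const _).trans (by rw [Finset.card_univ, Fintype.card_fin]))
  split_ifs
  · have := Finset.single_le_sum (f := fun y => |r y|) (fun _ _ => abs_nonneg _)
      (Finset.mem_range_succ_iff.2 (censRisk_le z b))
    linarith
  · simpa using hsum

section Integrability

variable (μ : Measure (Fin m → ℝ × ℝ)) [IsFiniteMeasure μ]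

theorem integrable_censProd (r : ℕ → ℝ) (x : ℝ) : Integrable (censProd r x) μ :=
  .of_bound ((measurable_censProd r m).comp measurable_prodMk_left).aestronglyMeasurable _
    (ae_of_all _ (abs_censProd_le r x))

theorem integrable_censProdCut (r : ℕ → ℝ) (d : ℕ) (x : ℝ) : Integrable (censProdCut r d x) μ := by
  have hmeas : MeasurableSet {z : Fin m → ℝ × ℝ | d ≤ riskAt x z} :=
    ((measurable_riskAt m).comp measurable_prodMk_left) measurableSet_Ici
  convert! (integrable_censProd μ r x).indicator hmeas using 1
  ext z
  simp [censProdCut, Set.indicator_apply]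

theorem integrable_comp_of_le {α : Type*} [MeasurableSpace α] {N : α → ℕ} (hN : Measurable N)
    {n : ℕ} (hn : ∀ a, N a ≤ n) (f : ℕ → ℝ) (μ : Measure α) [IsFiniteMeasure μ] :
    Integrable (fun a => f (N a)) μ :=
  .of_bound (measurable_from_top.comp hN).aestronglyMeasurable
    (∑ b ∈ Finset.range (n + 1), |f b|) <| ae_of_all _ fun a =>
      Finset.single_le_sum (f := fun b => |f b|) (fun _ _ => abs_nonneg _)
        (Finset.mem_range_succ_iff.2 (hn a))

theorem integrable_censOnlyProd (r : ℕ → ℝ) (d : ℕ) (x : ℝ) :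
    Integrable (fun z => censOnlyProd r d x fun i => (z i).2) μ :=
  integrable_comp_of_le ((measurable_tailCount x m).comp (by fun_prop))
    (fun _ => tailCount_le x _)
    (fun b => if d ≤ b then ∏ y ∈ Finset.Ioc b m, r y else 0) μ

theorem integrable_inv_riskAt (x : ℝ) :
    Integrable (fun z => 1 / ((riskAt x z : ℝ) + 1)) μ :=
  integrable_comp_of_le ((measurable_riskAt m).comp measurable_prodMk_left) (riskAt_le x)
    (fun b => 1 / ((b : ℝ) + 1)) μ

end Integrability

theorem integral_le_of_sum_comp_le {α ι : Type*} [MeasurableSpace α] {μ : Measure α} [Fintype ι]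
    [Nonempty ι] {φ : ι → α → α} (hφ : ∀ i, MeasurePreserving (φ i) μ μ) {f B : α → ℝ}
    (hf : Integrable f μ) (hB : Integrable B μ)
    (h : ∀ z, ∑ i, f (φ i z) ≤ Fintype.card ι * B z) : ∫ z, f z ∂μ ≤ ∫ z, B z ∂μ := by
  have hcomp : ∀ i, ∫ z, f (φ i z) ∂μ = ∫ z, f z ∂μ := fun i => by
    conv_rhs => rw [← (hφ i).map_eq]
    exact (integral_map (hφ i).aemeasurable ((hφ i).map_eq.symm ▸ hf.1)).symm
  have hint : ∀ i, Integrable (fun z => f (φ i z)) μ := fun i =>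
    (hφ i).integrable_comp_of_integrable hf
  refine le_of_mul_le_mul_left ?_ (Nat.cast_pos.2 (Fintype.card_pos (α := ι)))
  calc (Fintype.card ι : ℝ) * ∫ z, f z ∂μ = ∫ z, ∑ i, f (φ i z) ∂μ := by
        rw [integral_finsetSum _ fun i _ => hint i]
        simp [hcomp]
    _ ≤ ∫ z, Fintype.card ι * B z ∂μ :=
        integral_mono (integrable_finsetSum _ fun i _ => hint i) (hB.const_mul _) h
    _ = Fintype.card ι * ∫ z, B z ∂μ := integral_const_mul _ _

theorem measurePreserving_comp_perm {α : Type*} [MeasurableSpace α] (ν : Measure α)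
    [SigmaFinite ν] (π : Equiv.Perm (Fin m)) :
    MeasurePreserving (fun z : Fin m → α => z ∘ π) (Measure.pi fun _ => ν)
      (Measure.pi fun _ => ν) :=
  measurePreserving_arrowCongr' _ _ π.symm (.refl α) fun _ => .id ν

variable (F G : Measure ℝ) [IsProbabilityMeasure F] [IsProbabilityMeasure G]

/-- The law of `m` independent pairs of a survival time with law `F` and a censoring time with law
`G`. -/
def pairLaw (m : ℕ) : Measure (Fin m → ℝ × ℝ) := Measure.pi fun _ => F.prod G

instance (m : ℕ) : IsProbabilityMeasure (pairLaw F G m) := by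
  unfold pairLaw; infer_instance

theorem measurePreserving_perm_fst (π : Equiv.Perm (Fin m)) :
    MeasurePreserving (fun (z : Fin m → ℝ × ℝ) i => ((z (π i)).1, (z i).2))
      (pairLaw F G m) (pairLaw F G m) := by
  have hsplit := measurePreserving_arrowProdEquivProdArrow ℝ ℝ (Fin m) (fun _ => F) (fun _ => G)
  have hperm := (measurePreserving_comp_perm F π).prod
    (MeasurePreserving.id (Measure.pi fun _ : Fin m => G))
  exact (hsplit.symm _).comp (hperm.comp hsplit)

theorem integral_censProdCut_le {r : ℕ → ℝ} {d : ℕ} (hr0 : ∀ y, 0 ≤ r y)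
    (hr : MonotoneOn (fun y : ℕ => (y : ℝ) * (r y - 1)) (Set.Ici d)) (x : ℝ) (m : ℕ) :
    ∫ z, censProdCut r d x z ∂(pairLaw F G m) ≤
      ∫ z, censOnlyProd r d x (fun i => (z i).2) ∂(pairLaw F G m) := by
  refine integral_le_of_sum_comp_le (measurePreserving_perm_fst F G)
    (integrable_censProdCut _ r d x) (integrable_censOnlyProd _ r d x) fun z => ?_
  rw [Fintype.card_perm, Fintype.card_fin]
  exact sum_perm_censProdCut_le hr0 hr x (fun i => (z i).1) fun i => (z i).2

theorem prod_Ioc_riskFactor (k : ℕ) {N m : ℕ} (h : N ≤ m) :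
    ∏ y ∈ Finset.Ioc N m, riskFactor k y = ((m + k).choose m : ℝ) / (N + k).choose N := by
  refine prod_Ioc_eq_div (g := fun y => ((y + k).choose y : ℝ)) h
    (fun y _ => by exact_mod_cast (Nat.choose_pos (Nat.le_add_right y k)).ne') fun y _ => ?_
  have hpascal : ((y : ℝ) + k + 1) * (y + k).choose y = (y + 1 + k).choose (y + 1) * (y + 1) := by
    rw [show y + 1 + k = (y + k).succ by omega]
    exact_mod_cast Nat.add_one_mul_choose_eq (y + k) y
  unfold riskFactor
  push_cast
  field_simp
  linarith

theorem prod_Ioc_riskFactor_neg_one {N m : ℕ} (hN : 1 ≤ N) (h : N ≤ m) :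
    ∏ y ∈ Finset.Ioc N m, riskFactor (-1) y = (N : ℝ) / m := by
  have hpos : ∀ y : ℕ, N ≤ y → (0 : ℝ) < y := fun y hy => by exact_mod_cast hN.trans hy
  rw [prod_Ioc_eq_div (g := fun y => (y : ℝ)⁻¹) h (fun y hy => (inv_pos.2 (hpos y hy)).ne')
    fun y hy => ?_]
  · field_simp
  · have := hpos y hy
    unfold riskFactor
    push_cast
    field_simp
    ring

theorem pow_mul_integral_censProd_le (k m : ℕ) (x : ℝ) :
    G.real (Set.Ici x) ^ k * ∫ z, censProd (riskFactor k) x z ∂(pairLaw F G m) ≤ 1 := by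
  classical
  have hle := integral_censProdCut_le F G (d := 0)
    (riskFactor_nonneg (κ := k) (by linarith [k.cast_nonneg (α := ℝ)]))
    ((monotone_cast_mul_riskFactor_sub_one k.cast_nonneg).monotoneOn _) x m
  simp only [censProdCut, censOnlyProd, Nat.zero_le, if_true] at hle
  simp_rw [prod_Ioc_riskFactor k (tailCount_le x _)] at hle
  have hA : (F.prod G).real (Set.univ ×ˢ Set.Ici x) = G.real (Set.Ici x) := by
    simp [measureReal_prod_prod]
  have hbinom := pow_mul_integral_choose_div_choose_le (F.prod G) (A := Set.univ ×ˢ Set.Ici x)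
    (MeasurableSet.univ.prod measurableSet_Ici) m k
  simp only [hA, Set.mem_prod, Set.mem_univ, true_and, Set.mem_Ici] at hbinom
  refine (mul_le_mul_of_nonneg_left hle (by positivity)).trans ?_
  convert! hbinom

theorem integral_tailCount (m : ℕ) (x : ℝ) :
    ∫ z, (tailCount x (fun i => (z i).2) : ℝ) ∂(pairLaw F G m) = m * G.real (Set.Ici x) := by
  have hcoord : ∀ l, MeasurePreserving (fun z : Fin m → ℝ × ℝ => (z l).2) (pairLaw F G m) G :=
    fun l => measurePreserving_snd.comp (measurePreserving_eval _ l)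
  have hmeas : ∀ l, MeasurableSet ((fun z : Fin m → ℝ × ℝ => (z l).2) ⁻¹' Set.Ici x) :=
    fun l => (hcoord l).measurable measurableSet_Ici
  have hsum : ∀ z : Fin m → ℝ × ℝ, (tailCount x (fun i => (z i).2) : ℝ) =
      ∑ l, ((fun z : Fin m → ℝ × ℝ => (z l).2) ⁻¹' Set.Ici x).indicator 1 z := fun z => by
    classical simp [tailCount, Set.indicator_apply]
  simp_rw [hsum]
  rw [integral_finsetSum _ fun l _ => (integrable_const _).indicator (hmeas l)]
  simp [integral_indicator_one (hmeas _),
    (hcoord _).measureReal_preimage measurableSet_Ici.nullMeasurableSet]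

theorem integral_censProdCut_neg_one_le (m : ℕ) (x : ℝ) :
    ∫ z, censProdCut (riskFactor (-1)) 1 x z ∂(pairLaw F G m) ≤ G.real (Set.Ici x) := by
  have hpt : ∀ z : Fin m → ℝ × ℝ, censOnlyProd (riskFactor (-1)) 1 x (fun i => (z i).2) =
      tailCount x (fun i => (z i).2) / m := fun z => by
    unfold censOnlyProd
    split_ifs with h
    · exact prod_Ioc_riskFactor_neg_one h (card_finset_fin_le _)
    · simp [Nat.eq_zero_of_not_pos h]
  refine (integral_censProdCut_le F G (riskFactor_nonneg le_rfl)
    (monotoneOn_cast_mul_riskFactor_sub_one _) x m).trans ?_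
  simp_rw [hpt]
  rw [integral_div, integral_tailCount]
  exact div_le_of_le_mul₀ (by positivity) (by positivity) (mul_comm _ _).le

theorem mul_integral_inv_riskAt_le (m : ℕ) (x : ℝ) :
    F.real (Set.Ici x) * G.real (Set.Ici x) *
      ((m + 1 : ℝ) * ∫ z, 1 / ((riskAt x z : ℝ) + 1) ∂(pairLaw F G m)) ≤ 1 := by
  classical
  have hbinom := pow_mul_integral_choose_div_choose_le (F.prod G) (A := Set.Ici x ×ˢ Set.Ici x)
    (measurableSet_Ici.prod measurableSet_Ici) m 1
  rw [measureReal_prod_prod, pow_one] at hbinom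
  rw [← integral_const_mul]
  simp only [Set.mem_prod, Set.mem_Ici] at hbinom
  convert! hbinom using 4
  simp [riskAt, div_eq_mul_inv]

end

noncomputable section

variable {m : ℕ}

/-! ### Mean square consistency of the relative weights -/

theorem measurable_relWeight (m : ℕ) :
    Measurable fun p : ℝ × (Fin m → ℝ × ℝ) => relWeight p.1 p.2 :=
  measurable_censProd _ m

theorem memLp_two_relWeight (μ : Measure (Fin m → ℝ × ℝ)) [IsFiniteMeasure μ] (x : ℝ) :
    MemLp (relWeight x) 2 μ := by
  have hmeas := ((measurable_relWeight m).comp (measurable_prodMk_left (x := x)))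
  refine (memLp_two_iff_integrable_sq hmeas.aestronglyMeasurable).2 ?_
  simpa only [Function.comp_apply, relWeight_sq] using integrable_censProd μ _ x

theorem inv_riskAt_add_one_le_one (x : ℝ) (z : Fin m → ℝ × ℝ) :
    1 / ((riskAt x z : ℝ) + 1) ≤ 1 :=
  div_le_one_of_le₀ (le_add_of_nonneg_left (Nat.cast_nonneg _)) (by positivity)

theorem relWeight_sq_le_add (x : ℝ) (z : Fin m → ℝ × ℝ) {ε : ℝ} (hε : 0 < ε) :
    relWeight x z ^ 2 ≤ censProd (riskFactor 2) x z +
      (3 * ε * censProd (riskFactor 4) x z + 1 / (2 * ε) * (1 / ((riskAt x z : ℝ) + 1))) := by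
  set p := censProd (riskFactor 2) x z
  set ρ := 1 / ((riskAt x z : ℝ) + 1)
  have hsq : p ^ 2 ≤ 6 * censProd (riskFactor 4) x z := censProd_riskFactor_two_sq_le x z
  have hρ : ρ ^ 2 ≤ ρ :=
    pow_le_of_le_one (by positivity) (inv_riskAt_add_one_le_one x z) two_ne_zero
  have hamgm : p * ρ ≤ ε / 2 * p ^ 2 + 1 / (2 * ε) * ρ ^ 2 := by
    have hsq : 0 ≤ (ε * p - ρ) ^ 2 / (2 * ε) := by positivity
    have : (ε * p - ρ) ^ 2 / (2 * ε) = ε / 2 * p ^ 2 + 1 / (2 * ε) * ρ ^ 2 - p * ρ := by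
      field_simp
      ring
    linarith
  calc relWeight x z ^ 2 ≤ p + p * ρ := (relWeight_sq_le x z).trans_eq (mul_one_add p _)
    _ ≤ p + (ε / 2 * (6 * censProd (riskFactor 4) x z) + 1 / (2 * ε) * ρ) := by
      grw [hamgm, hsq, hρ]
    _ = _ := by ring

theorem sub_sq_le_add_inv {w a : ℝ} (hw : 0 < w) (ha : 0 ≤ a) :
    (w - a) ^ 2 ≤ w ^ 2 + 2 * a ^ 3 * w⁻¹ - 3 * a ^ 2 := by
  have hnonneg : 0 ≤ 2 * a * ((w - a) ^ 2 / w) := by positivity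
  have : 2 * a * ((w - a) ^ 2 / w) =
      w ^ 2 + 2 * a ^ 3 * w⁻¹ - 3 * a ^ 2 - (w - a) ^ 2 := by
    field_simp
    ring
  linarith

theorem relWeight_sub_sq_le (x : ℝ) (z : Fin m → ℝ × ℝ) {a ε : ℝ} (ha : 0 ≤ a) (hε : 0 < ε) :
    (relWeight x z - a) ^ 2 ≤ censProd (riskFactor 2) x z + 3 * ε * censProd (riskFactor 4) x z +
      2 * a ^ 3 * censProdCut (riskFactor (-1)) 1 x z +
      (1 / (2 * ε) + 4 * a ^ 3) * (1 / ((riskAt x z : ℝ) + 1)) - 3 * a ^ 2 := by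
  have hw := sub_sq_le_add_inv (zero_lt_one.trans_le (one_le_relWeight x z)) ha
  have hsq := relWeight_sq_le_add x z hε
  have hinv := mul_le_mul_of_nonneg_left (inv_relWeight_le x z) (by positivity : 0 ≤ 2 * a ^ 3)
  rw [div_eq_mul_one_div (2 : ℝ)] at hinv
  linarith

theorem integral_abs_le_sqrt {α : Type*} [MeasurableSpace α] {μ : Measure α}
    [IsProbabilityMeasure μ] {f : α → ℝ} (hf : MemLp f 2 μ) :
    ∫ z, |f z| ∂μ ≤ √(∫ z, f z ^ 2 ∂μ) := by
  refine Real.le_sqrt_of_sq_le ?_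
  have hvar := variance_eq_sub hf.abs ▸ variance_nonneg |f| μ
  simpa [sub_nonneg] using hvar

theorem tendsto_integral_abs_sq_sub_sq {α : ℕ → Type*} [∀ n, MeasurableSpace (α n)]
    {μ : ∀ n, Measure (α n)} [∀ n, IsProbabilityMeasure (μ n)] {f : ∀ n, α n → ℝ}
    (hf : ∀ n, MemLp (f n) 2 (μ n)) (a : ℝ)
    (h : Tendsto (fun n => ∫ z, (f n z - a) ^ 2 ∂μ n) atTop (𝓝 0)) :
    Tendsto (fun n => ∫ z, |f n z ^ 2 - a ^ 2| ∂μ n) atTop (𝓝 0) := by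
  have hlim : Tendsto (fun n => ∫ z, (f n z - a) ^ 2 ∂μ n +
      2 * |a| * √(∫ z, (f n z - a) ^ 2 ∂μ n)) atTop (𝓝 0) := by
    simpa using h.add (h.sqrt.const_mul (2 * |a|))
  refine squeeze_zero (fun n => integral_nonneg fun z => abs_nonneg _) (fun n => ?_) hlim
  have hsub : MemLp (fun z => f n z - a) 2 (μ n) := (hf n).sub (memLp_const a)
  have habs : Integrable (fun z => 2 * |a| * |f n z - a|) (μ n) :=
    ((hsub.integrable one_le_two).abs).const_mul _
  calc ∫ z, |f n z ^ 2 - a ^ 2| ∂μ n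
      ≤ ∫ z, ((f n z - a) ^ 2 + 2 * |a| * |f n z - a|) ∂μ n :=
        integral_mono ((hf n).integrable_sq.sub (integrable_const _)).abs
          (hsub.integrable_sq.add habs) fun z => by
            rw [show f n z ^ 2 - a ^ 2 = (f n z - a) ^ 2 + 2 * a * (f n z - a) by ring]
            refine (abs_add_le _ _).trans_eq ?_
            rw [abs_sq, abs_mul, abs_mul, abs_two]
    _ = ∫ z, (f n z - a) ^ 2 ∂μ n + 2 * |a| * ∫ z, |f n z - a| ∂μ n := by
        rw [integral_add hsub.integrable_sq habs, integral_const_mul]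
    _ ≤ _ := by grw [integral_abs_le_sqrt hsub]

variable (F G : Measure ℝ) [IsProbabilityMeasure F] [IsProbabilityMeasure G]

theorem sq_mul_integral_relWeight_sq_le (m : ℕ) (x : ℝ) :
    G.real (Set.Ici x) ^ 2 * ∫ z, relWeight x z ^ 2 ∂(pairLaw F G m) ≤ 2 := by
  have hle : ∫ z, relWeight x z ^ 2 ∂(pairLaw F G m) ≤
      ∫ z, 2 * censProd (riskFactor (2 : ℕ)) x z ∂(pairLaw F G m) :=
    integral_mono (memLp_two_relWeight _ x).integrable_sq
      ((integrable_censProd _ _ x).const_mul 2) fun z => by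
        have hp := censProd_nonneg (riskFactor_nonneg (κ := 2) (by norm_num)) x z
        have hρ := inv_riskAt_add_one_le_one x z
        have := relWeight_sq_le x z
        push_cast
        nlinarith
  rw [integral_const_mul] at hle
  nlinarith [pow_mul_integral_censProd_le F G 2 m x, sq_nonneg (G.real (Set.Ici x))]

variable {F G} {x : ℝ}

theorem integral_censProd_riskFactor_le (hg : 0 < G.real (Set.Ici x)) (k m : ℕ) :
    ∫ z, censProd (riskFactor k) x z ∂(pairLaw F G m) ≤ (G.real (Set.Ici x))⁻¹ ^ k := by
  rw [inv_pow, ← one_div, le_div_iff₀' (by positivity)]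
  exact pow_mul_integral_censProd_le F G k m x

theorem integral_inv_riskAt_le (hs : 0 < F.real (Set.Ici x)) (hg : 0 < G.real (Set.Ici x))
    (m : ℕ) :
    ∫ z, 1 / ((riskAt x z : ℝ) + 1) ∂(pairLaw F G m) ≤
      (G.real (Set.Ici x))⁻¹ / (F.real (Set.Ici x) * (m + 1)) := by
  rw [inv_eq_one_div, div_div, le_div_iff₀' (by positivity)]
  linarith [mul_integral_inv_riskAt_le F G m x]

theorem integral_relWeight_sub_sq_le (hs : 0 < F.real (Set.Ici x)) (hg : 0 < G.real (Set.Ici x))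
    (m : ℕ) {ε : ℝ} (hε : 0 < ε) :
    ∫ z, (relWeight x z - (G.real (Set.Ici x))⁻¹) ^ 2 ∂(pairLaw F G m) ≤
      3 * ε * (G.real (Set.Ici x))⁻¹ ^ 4 + (1 / (2 * ε) + 4 * (G.real (Set.Ici x))⁻¹ ^ 3) *
        ((G.real (Set.Ici x))⁻¹ / (F.real (Set.Ici x) * (m + 1))) := by
  have hp2 := integral_censProd_riskFactor_le (F := F) hg 2 m
  have hp4 := integral_censProd_riskFactor_le (F := F) hg 4 m
  have hq := integral_censProdCut_neg_one_le F G m x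
  have hρ := integral_inv_riskAt_le hs hg m
  push_cast at hp2 hp4
  have ip (r) := integrable_censProd (pairLaw F G m) r x
  have iq := integrable_censProdCut (pairLaw F G m) (riskFactor (-1)) 1 x
  have iρ := integrable_inv_riskAt (pairLaw F G m) x
  set a := (G.real (Set.Ici x))⁻¹ with ha
  have ha0 : 0 < a := by positivity
  have hga : a ^ 3 * G.real (Set.Ici x) = a ^ 2 := by rw [ha]; field_simp
  calc ∫ z, (relWeight x z - a) ^ 2 ∂(pairLaw F G m)
      ≤ ∫ z, (censProd (riskFactor 2) x z + 3 * ε * censProd (riskFactor 4) x z +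
          2 * a ^ 3 * censProdCut (riskFactor (-1)) 1 x z +
          (1 / (2 * ε) + 4 * a ^ 3) * (1 / ((riskAt x z : ℝ) + 1)) - 3 * a ^ 2)
          ∂(pairLaw F G m) :=
        integral_mono ((memLp_two_relWeight _ x).sub (memLp_const a)).integrable_sq
          (by fun_prop) fun z => relWeight_sub_sq_le x z ha0.le hε
    _ = ∫ z, censProd (riskFactor 2) x z ∂(pairLaw F G m) +
          3 * ε * ∫ z, censProd (riskFactor 4) x z ∂(pairLaw F G m) +
          2 * a ^ 3 * ∫ z, censProdCut (riskFactor (-1)) 1 x z ∂(pairLaw F G m) +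
          (1 / (2 * ε) + 4 * a ^ 3) * ∫ z, 1 / ((riskAt x z : ℝ) + 1) ∂(pairLaw F G m) -
          3 * a ^ 2 := by
        rw [integral_sub, integral_add, integral_add, integral_add]
        · simp only [integral_const_mul, integral_const, probReal_univ, one_smul]
        all_goals fun_prop
    _ ≤ a ^ 2 + 3 * ε * a ^ 4 + 2 * a ^ 3 * G.real (Set.Ici x) +
          (1 / (2 * ε) + 4 * a ^ 3) * (a / (F.real (Set.Ici x) * (m + 1))) - 3 * a ^ 2 := by
        gcongr
    _ = _ := by linear_combination 2 * hga

theorem tendsto_integral_relWeight_sub_sq (hs : 0 < F.real (Set.Ici x))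
    (hg : 0 < G.real (Set.Ici x)) :
    Tendsto (fun m => ∫ z, (relWeight x z - (G.real (Set.Ici x))⁻¹) ^ 2 ∂(pairLaw F G m))
      atTop (𝓝 0) := by
  have hbound := fun m : ℕ => integral_relWeight_sub_sq_le hs hg m (ε := (√(m + 1 : ℝ))⁻¹)
    (by positivity)
  set a := (G.real (Set.Ici x))⁻¹
  set s := F.real (Set.Ici x)
  have hr : Tendsto (fun m : ℕ => (√(m + 1 : ℝ))⁻¹) atTop (𝓝 0) :=
    tendsto_inv_atTop_zero.comp <| Real.tendsto_sqrt_atTop.comp <|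
      tendsto_atTop_add_const_right _ 1 tendsto_natCast_atTop_atTop
  have hlim : Tendsto (fun m : ℕ => (3 * a ^ 4 + a / (2 * s)) * (√(m + 1 : ℝ))⁻¹ +
      4 * a ^ 4 / s * ((√(m + 1 : ℝ))⁻¹ * (√(m + 1 : ℝ))⁻¹)) atTop (𝓝 0) := by
    simpa using (hr.const_mul (3 * a ^ 4 + a / (2 * s))).add
      ((hr.mul hr).const_mul (4 * a ^ 4 / s))
  refine squeeze_zero (fun m => integral_nonneg fun z => sq_nonneg _) (fun m => ?_) hlim
  have : 0 < √(m + 1 : ℝ) := by positivity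
  refine (hbound m).trans_eq ?_
  nth_rw 3 [← Real.sq_sqrt (by positivity : (0 : ℝ) ≤ m + 1)]
  field_simp
  ring

theorem tendsto_integral_abs_relWeight_sq_sub (hs : 0 < F.real (Set.Ici x))
    (hg : 0 < G.real (Set.Ici x)) :
    Tendsto (fun m => ∫ z, |relWeight x z ^ 2 - (G.real (Set.Ici x))⁻¹ ^ 2| ∂(pairLaw F G m))
      atTop (𝓝 0) :=
  tendsto_integral_abs_sq_sub_sq (fun _ => memLp_two_relWeight _ x) _
    (tendsto_integral_relWeight_sub_sq hs hg)

end

noncomputable section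

open scoped ENNReal

/-! ### Left tails of a law on the line -/

theorem survLeft_eq_measureReal_Ici (μ : Measure ℝ) [IsProbabilityMeasure μ] (x : ℝ) :
    survLeft μ x = μ.real (Set.Ici x) := by
  have h := (cdf μ).measure_Ici (tendsto_cdf_atTop μ) x
  have hle : Function.leftLim (cdf μ) x ≤ 1 :=
    ((monotone_cdf μ).leftLim_le le_rfl).trans (cdf_le_one μ x)
  rw [measure_cdf] at h
  rw [measureReal_def, h, ENNReal.toReal_ofReal (sub_nonneg.2 hle), survLeft]

theorem measure_setOf_measure_Ici_le (μ : Measure ℝ) [IsFiniteMeasure μ] (u : ℝ≥0∞) :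
    μ {x | μ (Set.Ici x) ≤ u} ≤ u := by
  have hup : IsUpperSet {x | μ (Set.Ici x) ≤ u} := fun x y hxy hx =>
    (measure_mono (Set.Ici_subset_Ici.2 hxy)).trans hx
  rw [hup.ordConnected.measurableSet.measure_eq_iSup_isCompact]
  refine iSup₂_le fun A hA => iSup_le fun hAc => ?_
  rcases A.eq_empty_or_nonempty with rfl | hne
  · simp
  · obtain ⟨a, ha, hmin⟩ := hAc.exists_isLeast hne
    exact (measure_mono hmin).trans (hA ha)

theorem ae_measureReal_Ici_pos (μ : Measure ℝ) [IsFiniteMeasure μ] :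
    ∀ᵐ x ∂μ, 0 < μ.real (Set.Ici x) := by
  have h : ∀ᵐ x ∂μ, ¬ μ (Set.Ici x) ≤ 0 := by
    simpa only [ae_iff, not_not, nonpos_iff_eq_zero] using measure_setOf_measure_Ici_le μ 0
  filter_upwards [h] with x hx
  exact ENNReal.toReal_pos (fun h0 => hx h0.le) (measure_ne_top _ _)

theorem measurable_measureReal_Ici (μ : Measure ℝ) [IsFiniteMeasure μ] :
    Measurable fun x => μ.real (Set.Ici x) :=
  Antitone.measurable fun _ _ h => measureReal_mono (Set.Ici_subset_Ici.2 h)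

/-! ### Convergence in measure -/

section TendstoInMeasure

variable {α ι E : Type*} [MeasurableSpace α] {μ : Measure α} {l : Filter ι}

theorem tendstoInMeasure_add [SeminormedAddCommGroup E] {f f' : ι → α → E} {g g' : α → E}
    (h : TendstoInMeasure μ f l g) (h' : TendstoInMeasure μ f' l g') :
    TendstoInMeasure μ (fun i => f i + f' i) l (g + g') := by
  intro ε hε
  have hsum := (h (ε / 2) (ENNReal.half_pos hε.ne')).add (h' (ε / 2) (ENNReal.half_pos hε.ne'))
  rw [add_zero] at hsum
  refine tendsto_of_tendsto_of_tendsto_of_le_of_le tendsto_const_nhds hsum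
    (fun _ => zero_le) fun i => (measure_mono fun x hx => ?_).trans (measure_union_le _ _)
  by_contra hx'
  simp only [Set.mem_union, Set.mem_ofPred_eq, not_or, not_le] at hx hx'
  refine hx.not_gt (lt_of_le_of_lt (edist_add_add_le ..) ?_)
  exact (ENNReal.add_lt_add hx'.1 hx'.2).trans_eq (ENNReal.add_halves ε)

theorem tendstoInMeasure_of_measure_ne_le [EDist E] {f : ι → α → E} {g : α → E}
    (h : ∀ c : ℝ, 0 < c → ∃ f', TendstoInMeasure μ f' l g ∧
      ∀ i, μ {x | f i x ≠ f' i x} ≤ ENNReal.ofReal c) :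
    TendstoInMeasure μ f l g := by
  intro ε hε
  refine ENNReal.tendsto_nhds_zero.2 fun η hη => ?_
  have hη' := ENNReal.half_pos hη.ne'
  obtain ⟨c, -, hc, hcη⟩ := ENNReal.lt_iff_exists_real_btwn.1 hη'
  obtain ⟨f', hf', hne⟩ := h c (ENNReal.ofReal_pos.1 hc)
  filter_upwards [ENNReal.tendsto_nhds_zero.1 (hf' ε hε) (η / 2) hη'] with i hi
  rw [← ENNReal.add_halves η]
  refine (measure_mono fun x hx => ?_).trans
    ((measure_union_le _ _).trans (add_le_add ((hne i).trans hcη.le) hi))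
  rcases ne_or_eq (f i x) (f' i x) with hxi | hxi
  · exact Or.inl hxi
  · exact Or.inr (by simpa only [Set.mem_ofPred_eq, hxi] using hx)

end TendstoInMeasure

/-! ### Expectations of sums over the uncensored observations -/

section UncensoredSum

variable {m : ℕ} {F G : Measure ℝ} [IsProbabilityMeasure F] [IsProbabilityMeasure G]

theorem measurePreserving_prodMk_removeNth (F G : Measure ℝ) [IsProbabilityMeasure F]
    [IsProbabilityMeasure G] (a : Fin (m + 1)) :
    MeasurePreserving (fun z : Fin (m + 1) → ℝ × ℝ => (z a, a.removeNth z)) (pairLaw F G (m + 1))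
      ((F.prod G).prod (pairLaw F G m)) :=
  measurePreserving_piFinSuccAbove (fun _ => F.prod G) a

theorem measurable_ite_uncensored {β : Type*} [Zero β] [MeasurableSpace β]
    {f : ℝ → (Fin m → ℝ × ℝ) → β} (hf : Measurable (Function.uncurry f)) (a : Fin (m + 1)) :
    Measurable fun z : Fin (m + 1) → ℝ × ℝ =>
      if (z a).1 ≤ (z a).2 then f (z a).1 (a.removeNth z) else 0 := by
  refine Measurable.ite (by measurability) (hf.comp (Measurable.prodMk ?_ ?_)) measurable_const
  · exact (measurable_pi_apply a).fst
  · exact measurable_pi_lambda _ fun i => measurable_pi_apply (a.succAbove i)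

theorem measurable_uncensoredSum {β : Type*} [AddCommMonoid β] [MeasurableSpace β]
    [MeasurableAdd₂ β] {f : ℝ → (Fin m → ℝ × ℝ) → β} (hf : Measurable (Function.uncurry f)) :
    Measurable (uncensoredSum f) :=
  Finset.measurable_sum _ fun a _ => measurable_ite_uncensored hf a

theorem enorm_uncensoredSum_le (f : ℝ → (Fin m → ℝ × ℝ) → ℝ) (z : Fin (m + 1) → ℝ × ℝ) :
    ‖uncensoredSum f z‖ₑ ≤ uncensoredSum (fun x y => ‖f x y‖ₑ) z := by
  refine (enorm_sum_le _ _).trans (Finset.sum_le_sum fun a _ => ?_)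
  split_ifs <;> simp

theorem lintegral_uncensoredSum {f : ℝ → (Fin m → ℝ × ℝ) → ℝ≥0∞}
    (hf : Measurable (Function.uncurry f)) :
    ∫⁻ z, uncensoredSum f z ∂pairLaw F G (m + 1) =
      (m + 1) * ∫⁻ x, G (Set.Ici x) * ∫⁻ y, f x y ∂pairLaw F G m ∂F := by
  have hmeas : Measurable fun q : (ℝ × ℝ) × (Fin m → ℝ × ℝ) =>
      if q.1.1 ≤ q.1.2 then f q.1.1 q.2 else 0 :=
    Measurable.ite (measurableSet_le (by fun_prop) (by fun_prop))
      (hf.comp (measurable_fst.fst.prodMk measurable_snd)) measurable_const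
  have hone (a : Fin (m + 1)) :
      ∫⁻ z, (if (z a).1 ≤ (z a).2 then f (z a).1 (a.removeNth z) else 0) ∂pairLaw F G (m + 1) =
        ∫⁻ x, G (Set.Ici x) * ∫⁻ y, f x y ∂pairLaw F G m ∂F := by
    refine ((measurePreserving_prodMk_removeNth F G a).lintegral_comp hmeas).trans ?_
    rw [lintegral_prod _ hmeas.aemeasurable,
      lintegral_prod _ hmeas.lintegral_prod_right'.aemeasurable]
    refine lintegral_congr fun x => ?_
    have hind (c : ℝ) : ∫⁻ y, (if x ≤ c then f x y else 0) ∂pairLaw F G m =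
        (Set.Ici x).indicator (fun _ => ∫⁻ y, f x y ∂pairLaw F G m) c := by
      by_cases h : x ≤ c <;> simp [h]
    simp only [hind]
    rw [lintegral_indicator_const measurableSet_Ici, mul_comm]
  simp only [uncensoredSum]
  rw [lintegral_finsetSum _ fun a _ => measurable_ite_uncensored hf a]
  simp [hone]

end UncensoredSum

end

noncomputable section

open scoped ENNReal

variable {Ω : Type*} [MeasurableSpace Ω] {P : Measure Ω} {F G : Measure ℝ}
  [IsProbabilityMeasure F] [IsProbabilityMeasure G]

/-! ### Censored samples -/

/-- `Z` is an infinite sample of independent pairs of a lifetime with law `F` and a censoring time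
with law `G`, encoded by the laws of its initial segments. -/
def IsCensoredSample (Z : ℕ → Ω → ℝ × ℝ) (F G : Measure ℝ) (P : Measure Ω) : Prop :=
  ∀ n, MeasurePreserving (fun ω (i : Fin n) => Z i ω) P (pairLaw F G n)

theorem isCensoredSample_of_iIndepFun [IsProbabilityMeasure P] {T C : ℕ → Ω → ℝ}
    (hTm : ∀ i, Measurable (T i)) (hCm : ∀ i, Measurable (C i))
    (hTlaw : ∀ i, P.map (T i) = F) (hClaw : ∀ i, P.map (C i) = G)
    (hTind : iIndepFun T P) (hCind : iIndepFun C P)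
    (hTC : IndepFun (fun ω i => T i ω) (fun ω i => C i ω) P) :
    IsCensoredSample (fun i ω => (T i ω, C i ω)) F G P := by
  intro n
  have hmeas {X : ℕ → Ω → ℝ} (hX : ∀ i, Measurable (X i)) :
      Measurable fun ω (i : Fin n) => X i ω := measurable_pi_lambda _ fun i => hX i
  have hmap {X : ℕ → Ω → ℝ} {μ : Measure ℝ} (hX : ∀ i, Measurable (X i))
      (hμ : ∀ i, P.map (X i) = μ) (hind : iIndepFun X P) :
      P.map (fun ω (i : Fin n) => X i ω) = Measure.pi fun _ => μ := by
    simpa only [hμ] using (iIndepFun_iff_map_fun_eq_pi_map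
      fun i : Fin n => (hX i).aemeasurable).1 (hind.precomp Fin.val_injective)
  have hprod := (indepFun_iff_map_prod_eq_prod_map_map (hmeas hTm).aemeasurable
    (hmeas hCm).aemeasurable).1 (hTC.comp
      (φ := fun (t : ℕ → ℝ) (i : Fin n) => t i) (ψ := fun (t : ℕ → ℝ) (i : Fin n) => t i)
      (by fun_prop) (by fun_prop))
  rw [hmap hTm hTlaw hTind, hmap hCm hClaw hCind] at hprod
  exact (measurePreserving_arrowProdEquivProdArrow ℝ ℝ (Fin n) (fun _ => F) fun _ => G).symm.comp
    ⟨(hmeas hTm).prodMk (hmeas hCm), hprod⟩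

namespace IsCensoredSample

variable {Z : ℕ → Ω → ℝ × ℝ} (hZ : IsCensoredSample Z F G P)

include hZ

theorem measurePreserving_apply (i : ℕ) : MeasurePreserving (Z i) P (F.prod G) :=
  (measurePreserving_eval (fun _ => F.prod G) (Fin.last i)).comp (hZ (i + 1))

theorem indepFun [IsProbabilityMeasure P] {i j : ℕ} (hij : i ≠ j) : IndepFun (Z i) (Z j) P := by
  have h : iIndepFun (fun l : Fin (max i j + 1) => Z l) P := by
    refine (iIndepFun_iff_map_fun_eq_pi_map fun l : Fin (max i j + 1) =>
      (hZ.measurePreserving_apply l).measurable.aemeasurable).2 ?_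
    simp_rw [(hZ.measurePreserving_apply _).map_eq]
    exact (hZ _).map_eq
  exact h.indepFun (i := ⟨i, by lia⟩) (j := ⟨j, by lia⟩) (by simpa [Fin.ext_iff] using hij)

theorem tendstoInMeasure_average [IsProbabilityMeasure P] {φ : ℝ × ℝ → ℝ} (hφ : Measurable φ)
    (hint : Integrable φ (F.prod G)) :
    TendstoInMeasure P (fun (n : ℕ) ω => (∑ i : Fin n, φ (Z i ω)) / n) atTop
      fun _ => ∫ q, φ q ∂F.prod G := by
  have hpres := hZ.measurePreserving_apply
  have hmeas (i : ℕ) : Measurable fun ω => φ (Z i ω) := hφ.comp (hpres i).measurable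
  have hident (i : ℕ) : IdentDistrib (Z i) (Z 0) P P :=
    ⟨(hpres i).measurable.aemeasurable, (hpres 0).measurable.aemeasurable,
      (hpres i).map_eq.trans (hpres 0).map_eq.symm⟩
  have hslln := strong_law_ae_real (fun i ω => φ (Z i ω))
    ((hpres 0).integrable_comp_of_integrable hint)
    (fun i j hij => (hZ.indepFun hij).comp hφ hφ) fun i => (hident i).comp hφ
  have hmean : ∫ ω, φ (Z 0 ω) ∂P = ∫ q, φ q ∂F.prod G := by
    rw [← (hpres 0).map_eq,
      integral_map (hpres 0).measurable.aemeasurable hφ.aestronglyMeasurable]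
  rw [hmean] at hslln
  simp only [Finset.sum_range] at hslln
  refine tendstoInMeasure_of_tendsto_ae (fun n => ?_) hslln
  exact ((Finset.measurable_sum _ fun (i : Fin n) _ => hmeas i).div_const _).aestronglyMeasurable

theorem lintegral_enorm_uncensoredSum_div_le {m : ℕ} {f : ℝ → (Fin m → ℝ × ℝ) → ℝ}
    (hf : Measurable (Function.uncurry f)) :
    ∫⁻ ω, ‖uncensoredSum f (fun i => Z i ω) / (m + 1)‖ₑ ∂P ≤
      ∫⁻ x, G (Set.Ici x) * ∫⁻ y, ‖f x y‖ₑ ∂pairLaw F G m ∂F := by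
  have hm : ‖((m : ℝ) + 1)⁻¹‖ₑ = ((m : ℝ≥0∞) + 1)⁻¹ := by
    rw [enorm_inv (by positivity), Real.enorm_eq_ofReal (by positivity),
      ENNReal.ofReal_add (by positivity) zero_le_one, ENNReal.ofReal_natCast, ENNReal.ofReal_one]
  calc ∫⁻ ω, ‖uncensoredSum f (fun i => Z i ω) / (m + 1)‖ₑ ∂P
      = ∫⁻ z, ‖uncensoredSum f z / (m + 1)‖ₑ ∂pairLaw F G (m + 1) :=
        (hZ (m + 1)).lintegral_comp ((measurable_uncensoredSum hf).div_const _).enorm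
    _ ≤ ∫⁻ z, uncensoredSum (fun x y => ‖f x y‖ₑ) z * (m + 1 : ℝ≥0∞)⁻¹ ∂pairLaw F G (m + 1) := by
        refine lintegral_mono fun z => ?_
        rw [div_eq_mul_inv, enorm_mul, hm]
        gcongr
        exact enorm_uncensoredSum_le f z
    _ = ∫⁻ x, G (Set.Ici x) * ∫⁻ y, ‖f x y‖ₑ ∂pairLaw F G m ∂F := by
        rw [lintegral_mul_const _ (measurable_uncensoredSum hf.enorm),
          lintegral_uncensoredSum hf.enorm, mul_comm, ← mul_assoc,
          ENNReal.inv_mul_cancel (by simp) (by finiteness), one_mul]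

theorem tendstoInMeasure_uncensoredSum_div {f : ∀ m : ℕ, ℝ → (Fin m → ℝ × ℝ) → ℝ}
    (hf : ∀ m, Measurable (Function.uncurry (f m)))
    (hint : ∀ m x, Integrable (f m x) (pairLaw F G m)) {b : ℝ → ℝ} (hb : Integrable b F)
    (hle : ∀ m x, G.real (Set.Ici x) * ∫ y, |f m x y| ∂pairLaw F G m ≤ b x)
    (hlim : ∀ᵐ x ∂F, Tendsto (fun m => G.real (Set.Ici x) * ∫ y, |f m x y| ∂pairLaw F G m)
      atTop (𝓝 0)) :
    TendstoInMeasure P (fun m ω => uncensoredSum (f m) (fun i => Z i ω) / (m + 1)) atTop 0 := by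
  have hterm (m : ℕ) (x : ℝ) : G (Set.Ici x) * ∫⁻ y, ‖f m x y‖ₑ ∂pairLaw F G m =
      ENNReal.ofReal (G.real (Set.Ici x) * ∫ y, |f m x y| ∂pairLaw F G m) := by
    rw [ENNReal.ofReal_mul measureReal_nonneg, ofReal_measureReal,
      ← ofReal_integral_norm_eq_lintegral_enorm (hint m x)]
    rfl
  refine tendstoInMeasure_of_tendsto_eLpNorm one_ne_zero (fun m => Measurable.aestronglyMeasurable
    (((measurable_uncensoredSum (hf m)).comp (hZ (m + 1)).measurable).div_const _))
    aestronglyMeasurable_const ?_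
  simp only [sub_zero, eLpNorm_one_eq_lintegral_enorm]
  refine tendsto_of_tendsto_of_tendsto_of_le_of_le tendsto_const_nhds ?_ (fun _ => zero_le)
    fun m => hZ.lintegral_enorm_uncensoredSum_div_le (hf m)
  simp only [hterm]
  rw [← lintegral_zero (μ := F)]
  refine tendsto_lintegral_of_dominated_convergence (fun x => ENNReal.ofReal (b x))
    (fun m => ?_) (fun m => ae_of_all _ fun x => ENNReal.ofReal_le_ofReal (hle m x))
    hb.lintegral_lt_top.ne ?_
  · exact ((measurable_measureReal_Ici G).mul
      (hf m).stronglyMeasurable.norm.integral_prod_right'.measurable).ennreal_ofReal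
  · filter_upwards [hlim] with x hx
    simpa using ENNReal.tendsto_ofReal hx

end IsCensoredSample

end

noncomputable section

variable {F G : Measure ℝ}

/-! ### The law of large numbers for the diagonal sum -/

theorem integral_ite_le (G : Measure ℝ) (x c : ℝ) :
    ∫ t, (if x ≤ t then c else 0) ∂G = G.real (Set.Ici x) * c := by
  have hind (t : ℝ) : (if x ≤ t then c else 0) = (Set.Ici x).indicator (fun _ => c) t := by
    by_cases h : x ≤ t <;> simp [h]
  simp only [hind]
  rw [integral_indicator_const c measurableSet_Ici, smul_eq_mul]

theorem measurable_ite_fst_le_snd {φ : ℝ → ℝ} (hφ : Measurable φ) :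
    Measurable fun q : ℝ × ℝ => if q.1 ≤ q.2 then φ q.1 else 0 :=
  Measurable.ite (measurableSet_le measurable_fst measurable_snd) (hφ.comp measurable_fst)
    measurable_const

theorem integrable_ite_fst_le_snd [IsFiniteMeasure G] {φ : ℝ → ℝ} (hφ : Measurable φ)
    (hint : Integrable (fun x => G.real (Set.Ici x) * φ x) F) :
    Integrable (fun q : ℝ × ℝ => if q.1 ≤ q.2 then φ q.1 else 0) (F.prod G) := by
  refine (integrable_prod_iff (measurable_ite_fst_le_snd hφ).aestronglyMeasurable).2
    ⟨ae_of_all _ fun x => ?_, hint.norm.congr (ae_of_all _ fun x => ?_)⟩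
  · exact .of_bound (C := |φ x|)
      ((measurable_ite_fst_le_snd hφ).comp measurable_prodMk_left).aestronglyMeasurable
      (ae_of_all _ fun t => by split_ifs <;> simp)
  · simp only [apply_ite norm, norm_zero, integral_ite_le, norm_mul, Real.norm_eq_abs,
      abs_of_nonneg measureReal_nonneg]

theorem integral_ite_fst_le_snd [SFinite F] [IsFiniteMeasure G] {φ : ℝ → ℝ} (hφ : Measurable φ)
    (hint : Integrable (fun x => G.real (Set.Ici x) * φ x) F) :
    ∫ q : ℝ × ℝ, (if q.1 ≤ q.2 then φ q.1 else 0) ∂F.prod G =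
      ∫ x, G.real (Set.Ici x) * φ x ∂F := by
  rw [integral_prod _ (integrable_ite_fst_le_snd hφ hint)]
  simp only [integral_ite_le]

variable [IsProbabilityMeasure F] [IsProbabilityMeasure G]

theorem sq_mul_integral_abs_relWeight_sq_sub_le (m : ℕ) (x : ℝ) :
    G.real (Set.Ici x) ^ 2 *
      ∫ z, |relWeight x z ^ 2 - (G.real (Set.Ici x))⁻¹ ^ 2| ∂pairLaw F G m ≤ 3 := by
  have hw := (memLp_two_relWeight (pairLaw F G m) x).integrable_sq
  set g := G.real (Set.Ici x)
  calc g ^ 2 * ∫ z, |relWeight x z ^ 2 - g⁻¹ ^ 2| ∂pairLaw F G m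
      ≤ g ^ 2 * ∫ z, (relWeight x z ^ 2 + g⁻¹ ^ 2) ∂pairLaw F G m := by
        refine mul_le_mul_of_nonneg_left (integral_mono (hw.sub (integrable_const _)).abs
          (hw.add (integrable_const _)) fun z => ?_) (sq_nonneg g)
        exact (abs_sub (relWeight x z ^ 2) (g⁻¹ ^ 2)).trans_eq
          (congrArg₂ _ (abs_of_nonneg (sq_nonneg _)) (abs_of_nonneg (sq_nonneg _)))
    _ = g ^ 2 * ∫ z, relWeight x z ^ 2 ∂pairLaw F G m + (g * g⁻¹) ^ 2 := by
        rw [integral_add hw (integrable_const _), integral_const, probReal_univ, one_smul]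
        ring
    _ ≤ 2 + 1 ^ 2 := by
        gcongr
        · exact sq_mul_integral_relWeight_sq_le F G m x
        · exact mul_inv_le_one
    _ = 3 := by norm_num

namespace IsCensoredSample

variable {Ω : Type*} [MeasurableSpace Ω] {P : Measure Ω}
  {Z : ℕ → Ω → ℝ × ℝ} (hZ : IsCensoredSample Z F G P)

include hZ

theorem tendstoInMeasure_uncensoredSum_inv_sq_div [IsProbabilityMeasure P] {k : ℝ → ℝ}
    (hk : Measurable k)
    (hint : Integrable (fun x => k x / G.real (Set.Ici x)) F) :
    TendstoInMeasure P (fun (m : ℕ) ω =>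
        uncensoredSum (fun x (_ : Fin m → ℝ × ℝ) => k x * (G.real (Set.Ici x))⁻¹ ^ 2)
          (fun i => Z i ω) / (m + 1))
      atTop fun _ => ∫ x, k x / G.real (Set.Ici x) ∂F := by
  have hmul (x : ℝ) : G.real (Set.Ici x) * (k x * (G.real (Set.Ici x))⁻¹ ^ 2) =
      k x / G.real (Set.Ici x) := by
    rcases eq_or_ne (G.real (Set.Ici x)) 0 with h | h
    · simp [h]
    · field_simp
  have hφ : Measurable fun x => k x * (G.real (Set.Ici x))⁻¹ ^ 2 :=
    hk.mul ((measurable_measureReal_Ici G).inv.pow_const 2)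
  have hint' : Integrable (fun x => G.real (Set.Ici x) * (k x * (G.real (Set.Ici x))⁻¹ ^ 2)) F := by
    simpa only [hmul] using hint
  have h := (hZ.tendstoInMeasure_average (measurable_ite_fst_le_snd hφ)
    (integrable_ite_fst_le_snd hφ hint')).comp (tendsto_add_atTop_nat 1)
  simp only [integral_ite_fst_le_snd hφ hint', hmul] at h
  exact h.congr_left fun m => ae_of_all _ fun ω => by simp [uncensoredSum]

theorem tendstoInMeasure_uncensoredSum_relWeight_sq_sub_div {k : ℝ → ℝ} (hk : Measurable k)
    (hint : Integrable (fun x => k x / G.real (Set.Ici x)) F) :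
    TendstoInMeasure P (fun (m : ℕ) ω => uncensoredSum (fun x (y : Fin m → ℝ × ℝ) =>
        k x * (relWeight x y ^ 2 - (G.real (Set.Ici x))⁻¹ ^ 2)) (fun i => Z i ω) / (m + 1))
      atTop 0 := by
  refine hZ.tendstoInMeasure_uncensoredSum_div (b := fun x => 3 * |k x / G.real (Set.Ici x)|)
    (fun m => ?_) (fun m x => ?_) (hint.abs.const_mul 3) (fun m x => ?_) ?_
  · exact (hk.comp measurable_fst).mul (((measurable_relWeight m).pow_const 2).sub
      (((measurable_measureReal_Ici G).comp measurable_fst).inv.pow_const 2))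
  · exact ((memLp_two_relWeight _ x).integrable_sq.sub (integrable_const _)).const_mul _
  · have h := sq_mul_integral_abs_relWeight_sq_sub_le (F := F) (G := G) m x
    simp only [abs_mul, integral_const_mul, abs_div, abs_of_nonneg measureReal_nonneg]
    rcases (measureReal_nonneg (μ := G) (s := Set.Ici x)).eq_or_lt with hg | hg
    · simp [← hg]
    · calc _ = |k x| / G.real (Set.Ici x) * (G.real (Set.Ici x) ^ 2 *
            ∫ z, |relWeight x z ^ 2 - (G.real (Set.Ici x))⁻¹ ^ 2| ∂pairLaw F G m) := by field_simp
        _ ≤ |k x| / G.real (Set.Ici x) * 3 := by gcongr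
        _ = _ := mul_comm ..
  · filter_upwards [ae_measureReal_Ici_pos F] with x hs
    rcases (measureReal_nonneg (μ := G) (s := Set.Ici x)).eq_or_lt with hg | hg
    · simp [← hg]
    · simp only [abs_mul, integral_const_mul]
      simpa using ((tendsto_integral_abs_relWeight_sq_sub hs hg).const_mul |k x|).const_mul
        (G.real (Set.Ici x))

theorem tendstoInMeasure_mul_kmDiag [IsProbabilityMeasure P] {K : ℝ → ℝ → ℝ}
    (hK : Measurable fun x => K x x)
    {σ : (n : ℕ) → Ω → Equiv.Perm (Fin n)}
    (hσ : ∀ n ω, IsKMOrder (sampleTime fun i : Fin n => Z i ω)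
      (sampleInd fun i : Fin n => Z i ω) (σ n ω))
    (hint : Integrable (fun x => K x x / G.real (Set.Ici x)) F) :
    TendstoInMeasure P (fun (n : ℕ) ω => n * kmDiag K (sampleTime fun i : Fin n => Z i ω)
        (sampleInd fun i : Fin n => Z i ω) (σ n ω))
      atTop fun _ => ∫ x, K x x / G.real (Set.Ici x) ∂F := by
  have h := tendstoInMeasure_add (hZ.tendstoInMeasure_uncensoredSum_relWeight_sq_sub_div hK hint)
    (hZ.tendstoInMeasure_uncensoredSum_inv_sq_div hK hint)
  rw [zero_add] at h
  refine fun ε hε => (tendsto_add_atTop_iff_nat 1).1 (TendstoInMeasure.congr_left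
    (fun m => ae_of_all _ fun ω => ?_) h ε hε)
  dsimp only [Pi.add_apply]
  rw [kmDiag_eq_uncensoredSum K _ (hσ (m + 1) ω), ← add_div, ← uncensoredSum_add,
    mul_uncensoredSum, div_eq_inv_mul, mul_uncensoredSum]
  congr 1 with x y
  push_cast
  field_simp
  ring

end IsCensoredSample

end

noncomputable section

/-! ### Truncation of the diagonal sum where few observations are at risk -/

theorem map_min_prod_apply_Ici (μ ν : Measure ℝ) [SFinite ν] (x : ℝ) :
    (μ.prod ν).map (fun q => min q.1 q.2) (Set.Ici x) = μ (Set.Ici x) * ν (Set.Ici x) := by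
  rw [Measure.map_apply (by fun_prop) measurableSet_Ici, ← Measure.prod_prod]
  congr 1 with q
  simp [Prod.le_def]

variable {F G : Measure ℝ} [IsProbabilityMeasure F] [IsProbabilityMeasure G]

/-- The summand `k x * wₓ ^ 2 / √n` of `n * (√n * Dₙ)` for `n = m + 1`, where `wₓ` is the relative
weight, truncated to the times `x` at which an observation is at risk with probability greater than
`c / n`. -/
def truncTerm (F G : Measure ℝ) (k : ℝ → ℝ) (c : ℝ) (m : ℕ) (x : ℝ) (y : Fin m → ℝ × ℝ) : ℝ :=
  if c / (m + 1) < F.real (Set.Ici x) * G.real (Set.Ici x) then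
    k x * relWeight x y ^ 2 / √(m + 1) else 0

theorem measurable_truncTerm {k : ℝ → ℝ} (hk : Measurable k) (c : ℝ) (m : ℕ) :
    Measurable (Function.uncurry (truncTerm F G k c m)) :=
  Measurable.ite (measurableSet_lt measurable_const
      (((measurable_measureReal_Ici F).mul (measurable_measureReal_Ici G)).comp measurable_fst))
    (((hk.comp measurable_fst).mul ((measurable_relWeight m).pow_const 2)).div_const _)
    measurable_const

theorem integrable_truncTerm (k : ℝ → ℝ) (c : ℝ) (m : ℕ) (x : ℝ) :
    Integrable (truncTerm F G k c m x) (pairLaw F G m) := by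
  unfold truncTerm
  split_ifs
  · exact ((memLp_two_relWeight _ x).integrable_sq.const_mul _).div_const _
  · exact integrable_zero ..

theorem mul_integral_abs_truncTerm_le (k : ℝ → ℝ) (c : ℝ) (m : ℕ) (x : ℝ) :
    G.real (Set.Ici x) * ∫ y, |truncTerm F G k c m x y| ∂pairLaw F G m ≤
      2 * |k x| / G.real (Set.Ici x) / √(m + 1) := by
  have hg : 0 ≤ G.real (Set.Ici x) := measureReal_nonneg
  unfold truncTerm
  split_ifs
  · have h := sq_mul_integral_relWeight_sq_le F G m x
    simp only [abs_div, abs_mul, abs_pow, sq_abs, integral_div, integral_const_mul,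
      abs_of_nonneg (Real.sqrt_nonneg _)]
    rcases hg.eq_or_lt with hg | hg
    · simp [← hg]
    · calc _ = |k x| / G.real (Set.Ici x) / √(m + 1) *
            (G.real (Set.Ici x) ^ 2 * ∫ y, relWeight x y ^ 2 ∂pairLaw F G m) := by field_simp
        _ ≤ |k x| / G.real (Set.Ici x) / √(m + 1) * 2 := by gcongr
        _ = _ := by ring
  · simp only [abs_zero, integral_zero, mul_zero]
    positivity

theorem mul_integral_abs_truncTerm_le_sqrt (k : ℝ → ℝ) {c : ℝ} (hc : 0 < c) (m : ℕ) (x : ℝ) :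
    G.real (Set.Ici x) * ∫ y, |truncTerm F G k c m x y| ∂pairLaw F G m ≤
      2 / √c * (|k x| * √(F.real (Set.Ici x) / G.real (Set.Ici x))) := by
  by_cases hcut : c / (m + 1) < F.real (Set.Ici x) * G.real (Set.Ici x)
  · refine (mul_integral_abs_truncTerm_le k c m x).trans ?_
    set s := F.real (Set.Ici x)
    set g := G.real (Set.Ici x)
    have hg : 0 < g := pos_of_mul_pos_right ((by positivity : 0 < c / (m + 1)).trans hcut)
      measureReal_nonneg
    have hsqrt : √c / √(m + 1) ≤ √(s / g) * g := by
      rw [← Real.sqrt_div hc.le]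
      refine (Real.sqrt_le_sqrt hcut.le).trans_eq ?_
      rw [show s * g = s / g * g ^ 2 by field_simp, Real.sqrt_mul (by positivity),
        Real.sqrt_sq hg.le]
    calc 2 * |k x| / g / √(m + 1) = 2 / √c * (|k x| * (√c / √(m + 1) / g)) := by field_simp
      _ ≤ 2 / √c * (|k x| * √(s / g)) := by
        gcongr
        exact (div_le_iff₀ hg).2 hsqrt
  · simp only [truncTerm, hcut, if_false, abs_zero, integral_zero, mul_zero]
    positivity

namespace IsCensoredSample

variable {Ω : Type*} [MeasurableSpace Ω] {P : Measure Ω} {Z : ℕ → Ω → ℝ × ℝ}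
  (hZ : IsCensoredSample Z F G P)

include hZ

theorem measurePreserving_min (i : ℕ) :
    MeasurePreserving (fun ω => min (Z i ω).1 (Z i ω).2) P
      ((F.prod G).map fun q => min q.1 q.2) :=
  ((measurable_fst.min measurable_snd).measurePreserving (F.prod G)).comp
    (hZ.measurePreserving_apply i)

theorem measure_exists_uncensored_le (n : ℕ) (u : ℝ) :
    P {ω | ∃ a : Fin n, (Z a ω).1 ≤ (Z a ω).2 ∧
      F.real (Set.Ici (Z a ω).1) * G.real (Set.Ici (Z a ω).1) ≤ u} ≤ n * ENNReal.ofReal u := by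
  set ν := (F.prod G).map fun q => min q.1 q.2
  set A := {x | ν (Set.Ici x) ≤ ENNReal.ofReal u}
  have hone (i : ℕ) : P ((fun ω => min (Z i ω).1 (Z i ω).2) ⁻¹' A) ≤ ENNReal.ofReal u :=
    ((hZ.measurePreserving_min i).measure_preimage_le A).trans (measure_setOf_measure_Ici_le ν _)
  calc _ ≤ P (⋃ a : Fin n, (fun ω => min (Z a ω).1 (Z a ω).2) ⁻¹' A) := by
        refine measure_mono fun ω ⟨a, hunc, hle⟩ => Set.mem_iUnion.2 ⟨a, ?_⟩
        simp only [A, ν, Set.mem_preimage, Set.mem_ofPred_eq, min_eq_left hunc,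
          map_min_prod_apply_Ici]
        rw [← ofReal_measureReal, ← ofReal_measureReal, ← ENNReal.ofReal_mul measureReal_nonneg]
        exact ENNReal.ofReal_le_ofReal hle
    _ ≤ ∑ _a : Fin n, ENNReal.ofReal u :=
        (measure_iUnion_fintype_le _ _).trans (Finset.sum_le_sum fun i _ => hone i)
    _ = _ := by simp

theorem tendstoInMeasure_uncensoredSum_truncTerm_div {k : ℝ → ℝ} (hk : Measurable k)
    (hint : Integrable (fun x => |k x| * √(F.real (Set.Ici x) / G.real (Set.Ici x))) F) {c : ℝ}
    (hc : 0 < c) :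
    TendstoInMeasure P (fun m ω =>
      uncensoredSum (truncTerm F G k c m) (fun i => Z i ω) / (m + 1)) atTop 0 := by
  refine hZ.tendstoInMeasure_uncensoredSum_div (measurable_truncTerm hk c)
    (integrable_truncTerm k c) (hint.const_mul (2 / √c))
    (mul_integral_abs_truncTerm_le_sqrt k hc) (ae_of_all _ fun x => ?_)
  have hlim : Tendsto (fun m : ℕ => 2 * |k x| / G.real (Set.Ici x) / √(m + 1)) atTop (𝓝 0) :=
    tendsto_const_nhds.div_atTop (Real.tendsto_sqrt_atTop.comp
      (tendsto_natCast_atTop_atTop.atTop_add tendsto_const_nhds))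
  exact squeeze_zero
    (fun m => mul_nonneg measureReal_nonneg (integral_nonneg fun _ => abs_nonneg _))
    (fun m => mul_integral_abs_truncTerm_le k c m x) hlim

theorem measure_sqrt_mul_kmDiag_ne_le (K : ℝ → ℝ → ℝ) {m : ℕ} {σ : Ω → Equiv.Perm (Fin (m + 1))}
    (hσ : ∀ ω, IsKMOrder (sampleTime fun i : Fin (m + 1) => Z i ω)
      (sampleInd fun i : Fin (m + 1) => Z i ω) (σ ω)) (c : ℝ) :
    P {ω | √(m + 1) * kmDiag K (sampleTime fun i : Fin (m + 1) => Z i ω)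
        (sampleInd fun i : Fin (m + 1) => Z i ω) (σ ω) ≠
      uncensoredSum (truncTerm F G (fun x => K x x) c m) (fun i => Z i ω) / (m + 1)} ≤
        ENNReal.ofReal c := by
  have hm : (0 : ℝ) < m + 1 := by positivity
  refine (measure_mono fun ω hω => ?_).trans
    ((hZ.measure_exists_uncensored_le (m + 1) (c / (m + 1))).trans_eq ?_)
  · by_contra hcut
    simp only [Set.mem_ofPred_eq, not_exists, not_and, not_le] at hcut
    refine hω ?_
    rw [kmDiag_eq_uncensoredSum K _ (hσ ω), mul_uncensoredSum, div_eq_inv_mul, mul_uncensoredSum]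
    refine Finset.sum_congr rfl fun _ _ => if_ctx_congr Iff.rfl (fun ha => ?_) fun _ => rfl
    simp only [truncTerm, if_pos (hcut _ ha)]
    have hsq : √((m : ℝ) + 1) ^ 2 = m + 1 := Real.sq_sqrt hm.le
    field_simp
    rw [hsq]
  · rw [← ENNReal.ofReal_natCast, ← ENNReal.ofReal_mul (by positivity)]
    push_cast
    rw [mul_div_cancel₀ _ hm.ne']

theorem tendstoInMeasure_sqrt_mul_kmDiag {K : ℝ → ℝ → ℝ} (hK : Measurable fun x => K x x)
    {σ : (n : ℕ) → Ω → Equiv.Perm (Fin n)}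
    (hσ : ∀ n ω, IsKMOrder (sampleTime fun i : Fin n => Z i ω)
      (sampleInd fun i : Fin n => Z i ω) (σ n ω))
    (hint : Integrable (fun x => |K x x| * √(F.real (Set.Ici x) / G.real (Set.Ici x))) F) :
    TendstoInMeasure P (fun (n : ℕ) ω => √n * kmDiag K (sampleTime fun i : Fin n => Z i ω)
      (sampleInd fun i : Fin n => Z i ω) (σ n ω)) atTop 0 := by
  refine fun ε hε => (tendsto_add_atTop_iff_nat 1).1
    (tendstoInMeasure_of_measure_ne_le (fun c hc => ?_) ε hε)
  refine ⟨_, hZ.tendstoInMeasure_uncensoredSum_truncTerm_div hK hint hc, fun m => ?_⟩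
  simpa only [Nat.cast_add, Nat.cast_one] using hZ.measure_sqrt_mul_kmDiag_ne_le K (hσ (m + 1)) c

end IsCensoredSample

end

noncomputable section

/-! ### The observable range -/

theorem measurable_survLeft (μ : Measure ℝ) [IsProbabilityMeasure μ] : Measurable (survLeft μ) := by
  simpa only [funext (survLeft_eq_measureReal_Ici μ)] using measurable_measureReal_Ici μ

theorem leftLim_cdf_lt_one_iff (μ : Measure ℝ) [IsProbabilityMeasure μ] (x : ℝ) :
    Function.leftLim (cdf μ) x < 1 ↔ 0 < μ.real (Set.Ici x) := by
  rw [← survLeft_eq_measureReal_Ici, survLeft, sub_pos]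

namespace IsCensoredSample

variable {Ω : Type*} [MeasurableSpace Ω] {P : Measure Ω} {F G : Measure ℝ}
  [IsProbabilityMeasure F] [IsProbabilityMeasure G] {Z : ℕ → Ω → ℝ × ℝ}

theorem measureReal_map_min_Ici (hZ : IsCensoredSample Z F G P) (i : ℕ) (x : ℝ) :
    (P.map fun ω => min (Z i ω).1 (Z i ω).2).real (Set.Ici x) =
      F.real (Set.Ici x) * G.real (Set.Ici x) := by
  rw [(hZ.measurePreserving_min i).map_eq, measureReal_def, map_min_prod_apply_Ici,
    ENNReal.toReal_mul]
  rfl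

theorem ae_survLeft_eq_zero (hZ : IsCensoredSample Z F G P) (i : ℕ) :
    ∀ᵐ x ∂F, ¬ Function.leftLim (cdf (P.map fun ω => min (Z i ω).1 (Z i ω).2)) x < 1 →
      survLeft G x = 0 := by
  have : IsProbabilityMeasure (P.map fun ω => min (Z i ω).1 (Z i ω).2) := by
    rw [(hZ.measurePreserving_min i).map_eq]
    exact Measure.isProbabilityMeasure_map (by fun_prop)
  filter_upwards [ae_measureReal_Ici_pos F] with x hx hnot
  rw [leftLim_cdf_lt_one_iff, hZ.measureReal_map_min_Ici, mul_pos_iff_of_pos_left hx,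
    not_lt] at hnot
  rw [survLeft_eq_measureReal_Ici]
  exact hnot.antisymm measureReal_nonneg

end IsCensoredSample

theorem mainTheorem7_general {Ω : Type*} [MeasurableSpace Ω] (P : Measure Ω)
    [IsProbabilityMeasure P] (F G : Measure ℝ) [IsProbabilityMeasure F] [IsProbabilityMeasure G]
    (T C : ℕ → Ω → ℝ)
    (hTm : ∀ i, Measurable (T i)) (hCm : ∀ i, Measurable (C i))
    (hTlaw : ∀ i, P.map (T i) = F) (hClaw : ∀ i, P.map (C i) = G)
    (hTind : iIndepFun T P) (hCind : iIndepFun C P)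
    (hTC : IndepFun (fun ω i => T i ω) (fun ω i => C i ω) P)
    (K : ℝ → ℝ → ℝ) (hK : Measurable fun x => K x x)
    (σ : (n : ℕ) → Ω → Equiv.Perm (Fin n))
    (hσ : ∀ n ω, IsKMOrder (fun i : Fin n => obsTime T C i ω)
      (fun i : Fin n => censInd T C i ω) (σ n ω)) :
    (IntegrableOn (fun x => |K x x| * √(survLeft F x / survLeft G x))
        {t | Function.leftLim (cdf (P.map (obsTime T C 0))) t < 1} F →
      TendstoInMeasure P
        (fun (n : ℕ) ω => √(n : ℝ) * kmDiag K (fun i : Fin n => obsTime T C i ω)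
          (fun i : Fin n => censInd T C i ω) (σ n ω))
        atTop (fun _ => 0)) ∧
    (IntegrableOn (fun x => |K x x| / survLeft G x)
        {t | Function.leftLim (cdf (P.map (obsTime T C 0))) t < 1} F →
      TendstoInMeasure P
        (fun (n : ℕ) ω => (n : ℝ) * kmDiag K (fun i : Fin n => obsTime T C i ω)
          (fun i : Fin n => censInd T C i ω) (σ n ω))
        atTop
        (fun _ => ∫ x in {t | Function.leftLim (cdf (P.map (obsTime T C 0))) t < 1},
          K x x / survLeft G x ∂F)) := by
  have hZ := isCensoredSample_of_iIndepFun hTm hCm hTlaw hClaw hTind hCind hTC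
  have hoff := hZ.ae_survLeft_eq_zero 0
  refine ⟨fun hint => hZ.tendstoInMeasure_sqrt_mul_kmDiag hK hσ ?_, fun hint => ?_⟩
  · simp only [← survLeft_eq_measureReal_Ici]
    refine hint.integrable_of_ae_notMem_eq_zero (hoff.mono fun x hx hnot => ?_)
    simp only [hx hnot, div_zero, Real.sqrt_zero, mul_zero]
  · rw [setIntegral_eq_integral_of_ae_compl_eq_zero
      (hoff.mono fun x hx hnot => by rw [hx hnot, div_zero])]
    simp only [survLeft_eq_measureReal_Ici]
    refine hZ.tendstoInMeasure_mul_kmDiag hK hσ ?_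
    simp only [← survLeft_eq_measureReal_Ici]
    refine (integrable_norm_iff (hK.div (measurable_survLeft G)).aestronglyMeasurable).1 ?_
    refine (hint.integrable_of_ae_notMem_eq_zero
      (hoff.mono fun x hx hnot => by rw [hx hnot, div_zero])).congr (ae_of_all _ fun x => ?_)
    simp only [Pi.div_apply, norm_div, Real.norm_eq_abs, survLeft_eq_measureReal_Ici,
      abs_of_nonneg measureReal_nonneg]

theorem setOf_leftLim_cdf_lt_one_ae_eq_obsInterval {F : Measure ℝ} (hF : F (Set.Iic 0) = 0)
    (μ : Measure ℝ) : {t | Function.leftLim (cdf μ) t < 1} =ᵐ[F] obsInterval μ := by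
  have hpos : ∀ᵐ x ∂F, 0 < x := by simpa [ae_iff, Set.Iic] using hF
  filter_upwards [hpos] with x hx
  exact propext (and_iff_right hx).symm

end

theorem mainTheorem7 {Ω : Type*} [MeasurableSpace Ω] (P : Measure Ω) [IsProbabilityMeasure P]
    (F G : Measure ℝ) [IsProbabilityMeasure F] [IsProbabilityMeasure G]
    (hF : F (Set.Iic 0) = 0) (hG : G (Set.Iic 0) = 0)
    (T C : ℕ → Ω → ℝ)
    (hTm : ∀ i, Measurable (T i)) (hCm : ∀ i, Measurable (C i))
    (hTlaw : ∀ i, P.map (T i) = F) (hClaw : ∀ i, P.map (C i) = G)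
    (hTind : iIndepFun T P) (hCind : iIndepFun C P)
    (hTC : IndepFun (fun ω i => T i ω) (fun ω i => C i ω) P)
    (K : ℝ → ℝ → ℝ) (hK : Measurable (Function.uncurry K))
    (σ : (n : ℕ) → Ω → Equiv.Perm (Fin n))
    (hσ : ∀ n ω, IsKMOrder (fun i : Fin n => obsTime T C i ω)
      (fun i : Fin n => censInd T C i ω) (σ n ω)) :
    (IntegrableOn (fun x => |K x x| * √(survLeft F x / survLeft G x))
        (obsInterval (P.map (obsTime T C 0))) F →
      TendstoInMeasure P
        (fun (n : ℕ) ω => √(n : ℝ) * kmDiag K (fun i : Fin n => obsTime T C i ω)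
          (fun i : Fin n => censInd T C i ω) (σ n ω))
        atTop (fun _ => 0)) ∧
    (IntegrableOn (fun x => |K x x| / survLeft G x)
        (obsInterval (P.map (obsTime T C 0))) F →
      TendstoInMeasure P
        (fun (n : ℕ) ω => (n : ℝ) * kmDiag K (fun i : Fin n => obsTime T C i ω)
          (fun i : Fin n => censInd T C i ω) (σ n ω))
        atTop
        (fun _ => ∫ x in obsInterval (P.map (obsTime T C 0)), K x x / survLeft G x ∂F)) := by
  have hae := setOf_leftLim_cdf_lt_one_ae_eq_obsInterval hF (P.map (obsTime T C 0))
  simpa only [integrableOn_congr_set_ae hae, setIntegral_congr_set hae] using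
    mainTheorem7_general P F G T C hTm hCm hTlaw hClaw hTind hCind hTC K
      (hK.comp (measurable_id.prodMk measurable_id)) σ hσ
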